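/- Let $X_2=\mathrm{GL}_2(\mathbb R)/\mathrm{GL}_2(\mathbb Z)$ be the space of lattices in $\mathbb R^2$ with the quotient topology, where the coset of $g$ is identified with the lattice $\Lambda=g\mathbb Z^2$, whose covolume is $d(\Lambda)=|\det g|$. By a *convex symmetric domain* we mean a non-empty bounded open convex set $K\subset\mathbb R^2$ with $K=-K$. A lattice $\Lambda$ is *$K$-admissible* if $\Lambda\cap K=\{0\}$; put $\Delta(K)=\inf\{d(\Lambda):\Lambda \text{ is } K\text{-admissible}\}$, and let the *critical locus* $\mathcal L(K)\subset X_2$ be the set of $K$-admissible lattices $\Lambda$ with $d(\Lambda)=\Delta(K)$. A convex symmetric domain $H$ is *irreducible* if $\Delta(H')<\Delta(H)$ for every convex symmetric domain $H'\subsetneq H$. **Corollary.** Let $K\subset\mathbb R^2$ be a convex symmetric domain that is not an (open) parallelogram. Then there is an irreducible convex symmetric domain $H\subseteq K$ that is not a parallelogram, with $\Delta(H)=\Delta(K)$, such that $\mathcal L(H)$ is an embedded circle in $X_2$ (the image of a topological embedding $\mathbb S^1\to X_2$), $\mathcal L(K)\subseteq\mathcal L(H)$, and $\mathcal L(K)$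 is closed in $X_2$, hence in $\mathcal L(H)$. -/

import Mathlib

/-- The plane `ℝ²` (its topology and its bounded sets are the usual ones). -/
abbrev Plane : Type := Fin 2 → ℝ

/-- The image of `GL₂(ℤ)` in `GL₂(ℝ)`. -/
def GLInt : Subgroup (GL (Fin 2) ℝ) :=
  (Matrix.GeneralLinearGroup.map (n := Fin 2) (Int.castRingHom ℝ)).range

/-- The space `X₂ = GL₂(ℝ) / GL₂(ℤ)` of lattices in `ℝ²`, with the quotient topology. The coset of
`g` stands for the lattice `g ℤ²`. -/
abbrev LatticeSpace : Type := GL (Fin 2) ℝ ⧸ GLInt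

/-- The set `g ℤ²`. -/
def latticeOf (g : GL (Fin 2) ℝ) : Set Plane :=
  {p | ∃ z : Fin 2 → ℤ, p = (g : Matrix (Fin 2) (Fin 2) ℝ).mulVec (fun i => (z i : ℝ))}

theorem latticeOf_mul_subset (g : GL (Fin 2) ℝ) (γ : GL (Fin 2) ℤ) :
    latticeOf (g * Matrix.GeneralLinearGroup.map (Int.castRingHom ℝ) γ) ⊆ latticeOf g := by
  rintro p ⟨z, rfl⟩
  refine ⟨(γ : Matrix (Fin 2) (Fin 2) ℤ).mulVec z, ?_⟩
  rw [Units.val_mul, ← Matrix.mulVec_mulVec]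
  congr 1
  ext i
  simp [Matrix.mulVec, dotProduct]

theorem latticeOf_eq_of_rel (g h : GL (Fin 2) ℝ) (hgh : QuotientGroup.leftRel GLInt g h) :
    latticeOf g = latticeOf h := by
  rw [QuotientGroup.leftRel_apply] at hgh
  obtain ⟨γ, hγ⟩ := hgh
  have h1 : h = g * Matrix.GeneralLinearGroup.map (Int.castRingHom ℝ) γ := by
    rw [hγ]; group
  have h2 : g = h * Matrix.GeneralLinearGroup.map (Int.castRingHom ℝ) γ⁻¹ := by
    rw [map_inv, hγ]; group
  apply Set.Subset.antisymm
  · conv_lhs => rw [h2]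
    exact latticeOf_mul_subset h γ⁻¹
  · conv_lhs => rw [h1]
    exact latticeOf_mul_subset g γ

theorem abs_det_eq_of_rel (g h : GL (Fin 2) ℝ) (hgh : QuotientGroup.leftRel GLInt g h) :
    |(g : Matrix (Fin 2) (Fin 2) ℝ).det| = |(h : Matrix (Fin 2) (Fin 2) ℝ).det| := by
  rw [QuotientGroup.leftRel_apply] at hgh
  obtain ⟨γ, hγ⟩ := hgh
  have h1 : h = g * Matrix.GeneralLinearGroup.map (Int.castRingHom ℝ) γ := by
    rw [hγ]; group
  have h3 : (Matrix.GeneralLinearGroup.map (Int.castRingHom ℝ) γ : Matrix (Fin 2) (Fin 2) ℝ).det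
      = (((γ : Matrix (Fin 2) (Fin 2) ℤ).det : ℤ) : ℝ) :=
    ((Int.castRingHom ℝ).map_det (γ : Matrix (Fin 2) (Fin 2) ℤ)).symm
  have h4 : |(γ : Matrix (Fin 2) (Fin 2) ℤ).det| = 1 :=
    Int.isUnit_iff_abs_eq.mp ((Matrix.isUnit_iff_isUnit_det _).mp γ.isUnit)
  rw [h1, Units.val_mul, Matrix.det_mul, abs_mul, h3, ← Int.cast_abs, h4]
  simp

/-- The set of points of a lattice; on the coset of `g` it is `g ℤ²`. -/
def LatticeSpace.points (L : LatticeSpace) : Set Plane :=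
  Quotient.liftOn L latticeOf latticeOf_eq_of_rel

/-- The covolume `d(Λ)`; on the coset of `g` it is `|det g|`. -/
noncomputable def LatticeSpace.covol (L : LatticeSpace) : ℝ :=
  Quotient.liftOn L (fun g => |(g : Matrix (Fin 2) (Fin 2) ℝ).det|) abs_det_eq_of_rel

/-- A (bounded, convex) domain in the plane, symmetric about the origin. -/
structure IsSymmConvexDomain (K : Set Plane) : Prop where
  isOpen : IsOpen K
  nonempty : K.Nonempty
  convex : Convex ℝ K
  isBounded : Bornology.IsBounded K
  symm : ∀ x ∈ K, -x ∈ K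

/-- `Λ` is `K`-admissible: `Λ ∩ K = {0}`. -/
def IsAdmissible (K : Set Plane) (L : LatticeSpace) : Prop :=
  L.points ∩ K = {0}

/-- The critical determinant `Δ(K)`. For bounded `K` containing `0` the set of covolumes is
nonempty, and it is bounded below by `0`, so this is its true infimum. -/
noncomputable def criticalDet (K : Set Plane) : ℝ :=
  sInf {d : ℝ | ∃ L : LatticeSpace, IsAdmissible K L ∧ L.covol = d}

/-- The critical locus `𝓛(K)`, as a subset of the space of lattices. -/
def criticalLocus (K : Set Plane) : Set LatticeSpace :=
  {L | IsAdmissible K L ∧ L.covol = criticalDet K}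

/-- `K` is irreducible: every strictly smaller bounded convex symmetric domain has a strictly
smaller critical determinant. -/
def IsIrreducibleDomain (K : Set Plane) : Prop :=
  IsSymmConvexDomain K ∧
    ∀ H : Set Plane, IsSymmConvexDomain H → H ⊂ K → criticalDet H < criticalDet K

/-- `K` is a (nondegenerate, open) parallelogram, with centre `c` and sides `2u`, `2v`. -/
def IsParallelogram (K : Set Plane) : Prop :=
  ∃ c u v : Plane, LinearIndependent ℝ ![u, v] ∧
    K = {p | ∃ a b : ℝ, a ∈ Set.Ioo (-1 : ℝ) 1 ∧ b ∈ Set.Ioo (-1 : ℝ) 1 ∧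
      p = c + a • u + b • v}

/-- `S` is an embedded circle in `X`: the image of a topological embedding of the circle. -/
def IsEmbeddedCircle {X : Type*} [TopologicalSpace X] (S : Set X) : Prop :=
  ∃ f : Circle → X, Topology.IsEmbedding f ∧ Set.range f = S

/-!
Fix a convex symmetric domain `K` with norm `gauge K`, write `wedge p q` for the determinant of two
vectors and `Δ` for `criticalDet K`. Everything is expressed through inscribed hexagons: boundary
vectors `p`, `q` of `K` for which `q - p` is a boundary vector as well. The lattice generated by an
inscribed hexagon is admissible (`IsSymmConvexDomain.isAdmissible_of_hexagon`), and a shortest vector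
of an admissible lattice leads to an inscribed hexagon of no larger determinant
(`IsSymmConvexDomain.exists_hexagon_le_covol`). Hence `Δ` is the least determinant of an inscribed
hexagon; those attaining it are called critical.

If `K` is not a parallelogram, the side of a critical hexagon parallel to `p` cannot lie on a
supporting line of `K` (`IsSymmConvexDomain.exists_gauge_line_lt_one`): that line and a supporting
line at `p` would bound a parallelogram of critical determinant `Δ` around `K`, and a domain properly
inside a parallelogram has a smaller critical determinant. It follows that a critical hexagon is
determined by one vertex, that its vertices are the only boundary points of its lattice, and that all
critical lattices come from critical hexagons
(`IsSymmConvexDomain.exists_criticalHexagon_of_mem`). Two different critical hexagons interlace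
(`IsCriticalHexagon.eq_of_inCone`, `IsCriticalHexagon.inCone_next`): each has exactly one vertex in
the half-open cone between two consecutive vertices of the other
(`IsCriticalHexagon.exists_vertex_inCone`, `IsCriticalHexagon.eq_of_mem_points_of_inCone`).

If moreover `K` is irreducible, every face of the closure of `K` meets a critical lattice, as one
sees by cutting off small caps (`IsIrreducibleDomain.exists_criticalHexagon_on_face`). A boundary
arc free of critical vertices is therefore a segment. If there were such a gap between two critical
vertices `p`, `p'`, the corresponding arcs from `q` to `q'` and from `q - p` to `q' - p'` would be
gaps too, and the midpoints of the three segments would form another critical hexagon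
(`IsIrreducibleDomain.exists_vertex_between`). So every boundary point is a vertex of exactly one
critical hexagon. The boundary arc between consecutive vertices `p`, `q` of one critical hexagon thus
parametrizes the critical locus, with the two end points giving the same lattice, and the locus is a
circle (`IsIrreducibleDomain.isEmbeddedCircle_criticalLocus`).

An irreducible `H ⊆ K` with the same critical determinant exists by Zorn's lemma
(`IsSymmConvexDomain.exists_irreducible_subset`). It is not a parallelogram, since by Minkowski's
theorem a domain properly containing a parallelogram has a larger critical determinant
(`criticalDet_lt_of_isParallelogram`). A critical lattice of `K` is `H`-admissible of covolume
`Δ(H)`, hence critical for `H`.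
-/

/-! ### The determinant of two vectors in the plane -/

/-- The determinant of the pair `(p, q)` of plane vectors, the oriented area of the parallelogram
they span. -/
def wedge (p q : Plane) : ℝ := p 0 * q 1 - p 1 * q 0

section Wedge

variable (p q r v : Plane) (a b c d : ℝ)

theorem wedge_self : wedge p p = 0 := by simp only [wedge]; ring

theorem wedge_swap : wedge q p = -wedge p q := by simp only [wedge]; ring

theorem wedge_neg_left : wedge (-p) q = -wedge p q := by simp [wedge]; ring

theorem wedge_neg_right : wedge p (-q) = -wedge p q := by simp [wedge]; ring

theorem wedge_comb : wedge (a • p + b • q) (c • p + d • q) = (a * d - b * c) * wedge p q := by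
  simp [wedge]; ring

theorem wedge_comb_right : wedge r (a • p + b • q) = a * wedge r p + b * wedge r q := by
  simp [wedge]; ring

theorem wedge_comb_left : wedge (a • p + b • q) r = a * wedge p r + b * wedge q r := by
  simp [wedge]; ring

theorem wedge_sub_right : wedge p (q - r) = wedge p q - wedge p r := by simp [wedge]; ring

theorem wedge_sub_left : wedge (p - q) r = wedge p r - wedge q r := by simp [wedge]; ring

theorem wedge_smul_right : wedge p (a • q) = a * wedge p q := by simp [wedge]; ring

theorem wedge_smul_left : wedge (a • p) q = a * wedge p q := by simp [wedge]; ring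

variable {p q}

/-- Cramer's rule. -/
theorem wedge_smul_eq : wedge p q • v = wedge v q • p + wedge p v • q := by
  ext i; fin_cases i <;> simp [wedge] <;> ring

theorem eq_comb_of_wedge_ne_zero (h : wedge p q ≠ 0) :
    v = (wedge v q / wedge p q) • p + (wedge p v / wedge p q) • q := by
  have := wedge_smul_eq v (p := p) (q := q)
  calc v = (wedge p q)⁻¹ • (wedge p q • v) := by rw [smul_smul, inv_mul_cancel₀ h, one_smul]
    _ = _ := by rw [this, smul_add, smul_smul, smul_smul]; congr 2 <;> ring_nf

theorem exists_comb_of_wedge_ne_zero (h : wedge p q ≠ 0) : ∃ x y : ℝ, v = x • p + y • q :=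
  ⟨_, _, eq_comb_of_wedge_ne_zero v h⟩

theorem continuous_wedge : Continuous fun x : Plane × Plane => wedge x.1 x.2 := by
  unfold wedge; fun_prop

end Wedge

/-! ### The norm of a convex symmetric domain -/

theorem ne_zero_of_gauge_eq_one {K : Set Plane} {x : Plane} (hx : gauge K x = 1) : x ≠ 0 := by
  rintro rfl; simp at hx

namespace IsSymmConvexDomain

variable {K : Set Plane} (hK : IsSymmConvexDomain K)

include hK

theorem zero_mem : (0 : Plane) ∈ K := by
  obtain ⟨x, hx⟩ := hK.nonempty
  have := hK.convex hx (hK.symm x hx) (by norm_num : (0 : ℝ) ≤ 1 / 2)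
    (by norm_num : (0 : ℝ) ≤ 1 / 2) (by norm_num)
  simpa using this

theorem mem_nhds_zero : K ∈ nhds (0 : Plane) := hK.isOpen.mem_nhds hK.zero_mem

theorem absorbent : Absorbent ℝ K := absorbent_nhds_zero hK.mem_nhds_zero

theorem gauge_add (x y : Plane) : gauge K (x + y) ≤ gauge K x + gauge K y :=
  gauge_add_le hK.convex hK.absorbent x y

theorem gauge_neg (x : Plane) : gauge K (-x) = gauge K x := _root_.gauge_neg hK.symm x

theorem gauge_sub_comm (x y : Plane) : gauge K (x - y) = gauge K (y - x) := by
  rw [← hK.gauge_neg, neg_sub]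

theorem gauge_smul (a : ℝ) (x : Plane) : gauge K (a • x) = |a| * gauge K x := by
  rcases le_total 0 a with h | h
  · rw [gauge_smul_of_nonneg h, abs_of_nonneg h, smul_eq_mul]
  · rw [abs_of_nonpos h, ← hK.gauge_neg, ← neg_smul, gauge_smul_of_nonneg (by linarith),
      smul_eq_mul]

theorem gauge_comb (a b : ℝ) (x y : Plane) :
    gauge K (a • x + b • y) ≤ |a| * gauge K x + |b| * gauge K y := by
  rw [← hK.gauge_smul, ← hK.gauge_smul]; exact hK.gauge_add _ _

theorem gauge_lt_one_iff (x : Plane) : gauge K x < 1 ↔ x ∈ K := by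
  rw [gauge_lt_one_iff_mem_interior hK.convex hK.mem_nhds_zero, hK.isOpen.interior_eq]

theorem one_le_gauge_iff (x : Plane) : 1 ≤ gauge K x ↔ x ∉ K := by
  rw [← hK.gauge_lt_one_iff, not_lt]

theorem gauge_pos {x : Plane} (hx : x ≠ 0) : 0 < gauge K x :=
  (_root_.gauge_pos hK.absorbent
    (NormedSpace.isVonNBounded_of_isBounded _ hK.isBounded)).2 hx

theorem continuous_gauge : Continuous (gauge K) :=
  _root_.continuous_gauge hK.convex hK.mem_nhds_zero

theorem isCompact_closure : IsCompact (closure K) := hK.isBounded.isCompact_closure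

theorem gauge_le_one_iff (x : Plane) : gauge K x ≤ 1 ↔ x ∈ closure K :=
  gauge_le_one_iff_mem_closure hK.convex hK.mem_nhds_zero

theorem isCompact_gauge_le_one : IsCompact {x | gauge K x ≤ 1} := by
  convert hK.isCompact_closure using 1
  ext x; exact hK.gauge_le_one_iff x

theorem gauge_anti {K' : Set Plane} (h : K ⊆ K') (x : Plane) :
    gauge K' x ≤ gauge K x := gauge_mono hK.absorbent h x

theorem exists_gauge_le_norm : ∃ C > 0, ∀ x, ‖x‖ ≤ C * gauge K x := by
  obtain ⟨R, hR, hKR⟩ := hK.isBounded.subset_closedBall_lt 0 0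
  refine ⟨R, hR, fun x => ?_⟩
  have := le_gauge_of_subset_closedBall hK.absorbent hR.le hKR (x := x)
  rwa [div_le_iff₀ hR, mul_comm] at this

/-- Convexity of the norm along a line, at an interior point of a segment. -/
theorem gauge_line_le (q p : Plane) {s t τ : ℝ} (h1 : s ≤ t) (h2 : t ≤ τ) :
    (τ - s) * gauge K (q + t • p) ≤
      (τ - t) * gauge K (q + s • p) + (t - s) * gauge K (q + τ • p) := by
  have h3 : (τ - s) • (q + t • p) = (τ - t) • (q + s • p) + (t - s) • (q + τ • p) := by module
  have h4 := hK.gauge_comb (τ - t) (t - s) (q + s • p) (q + τ • p)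
  rwa [← h3, hK.gauge_smul, abs_of_nonneg (by linarith), abs_of_nonneg (by linarith),
    abs_of_nonneg (by linarith)] at h4

theorem wedge_ne_zero {p q : Plane} (h1 : gauge K p = 1) (h2 : gauge K q = 1)
    (h3 : gauge K (q - p) = 1) : wedge p q ≠ 0 := by
  intro h
  -- otherwise `q = ± p`, and `q - p` has norm `0` or `2`
  obtain ⟨a, ha⟩ : ∃ a : ℝ, q = a • p := by
    by_cases h0 : p 0 = 0
    · have hp1 : p 1 ≠ 0 := by
        intro h1'
        exact ne_zero_of_gauge_eq_one h1 (by ext i; fin_cases i <;> simp [h0, h1'])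
      refine ⟨q 1 / p 1, ?_⟩
      simp only [wedge, h0] at h
      have : q 0 = 0 := by
        rcases mul_eq_zero.1 (show p 1 * q 0 = 0 by linarith) with h | h
        · exact absurd h hp1
        · exact h
      ext i; fin_cases i
      · simp [h0, this]
      · simp [hp1]
    · refine ⟨q 0 / p 0, ?_⟩
      simp only [wedge] at h
      ext i; fin_cases i
      · simp [h0]
      · simp; field_simp; linarith
  subst ha
  have h4 : a • p - p = (a - 1) • p := by module
  rw [hK.gauge_smul, h1, mul_one] at h2
  rw [h4, hK.gauge_smul, h1, mul_one] at h3
  rcases abs_cases a with h | h <;> rcases abs_cases (a - 1) with h' | h' <;> linarith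

end IsSymmConvexDomain

/-! ### Lattices given by a basis -/

theorem det_columns (p q : Plane) : (!![p 0, q 0; p 1, q 1] : Matrix (Fin 2) (Fin 2) ℝ).det =
    wedge p q := by rw [Matrix.det_fin_two_of, wedge]; ring

/-- The invertible matrix with columns `p`, `q`. -/
noncomputable def columnsGL (p q : Plane) (h : wedge p q ≠ 0) : GL (Fin 2) ℝ :=
  Matrix.GeneralLinearGroup.mkOfDetNeZero !![p 0, q 0; p 1, q 1] (by rwa [det_columns])

theorem columnsGL_val (p q : Plane) (h : wedge p q ≠ 0) :
    (columnsGL p q h : Matrix (Fin 2) (Fin 2) ℝ) = !![p 0, q 0; p 1, q 1] := rfl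

/-- The lattice with basis `p`, `q`. -/
noncomputable def latticeMk (p q : Plane) (h : wedge p q ≠ 0) : LatticeSpace :=
  (columnsGL p q h : GL (Fin 2) ℝ ⧸ GLInt)

theorem exists_latticeMk (L : LatticeSpace) : ∃ p q h, latticeMk p q h = L := by
  induction L using QuotientGroup.induction_on with
  | H g =>
    have hdet : wedge (fun i => g.1 i 0) (fun i => g.1 i 1) = g.1.det := by
      rw [Matrix.det_fin_two, wedge]; ring
    have h0 : g.1.det ≠ 0 := ((Matrix.isUnit_iff_isUnit_det _).1 g.isUnit).ne_zero
    refine ⟨fun i => g.1 i 0, fun i => g.1 i 1, hdet ▸ h0, ?_⟩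
    unfold latticeMk
    congr 1
    ext i j
    fin_cases i <;> fin_cases j <;> rfl

theorem mem_points_latticeMk {p q : Plane} (h : wedge p q ≠ 0) (x : Plane) :
    x ∈ (latticeMk p q h).points ↔ ∃ a b : ℤ, x = (a : ℝ) • p + (b : ℝ) • q := by
  change x ∈ latticeOf (columnsGL p q h) ↔ _
  have key : ∀ z : Fin 2 → ℤ, (columnsGL p q h : Matrix (Fin 2) (Fin 2) ℝ).mulVec
      (fun i => (z i : ℝ)) = (z 0 : ℝ) • p + (z 1 : ℝ) • q := by
    intro z
    ext i
    fin_cases i <;> simp [columnsGL_val, Matrix.mulVec, dotProduct, Fin.sum_univ_two] <;> ring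
  constructor
  · rintro ⟨z, rfl⟩
    exact ⟨z 0, z 1, key z⟩
  · rintro ⟨a, b, rfl⟩
    exact ⟨![a, b], by rw [key]; simp⟩

theorem covol_latticeMk {p q : Plane} (h : wedge p q ≠ 0) :
    (latticeMk p q h).covol = |wedge p q| := by
  change |(columnsGL p q h : Matrix (Fin 2) (Fin 2) ℝ).det| = _
  rw [columnsGL_val, det_columns]

/-- A unimodular change of basis does not change the lattice. -/
theorem latticeMk_eq_of_unimodular {p q p' q' : Plane} (h : wedge p q ≠ 0) {a b c d : ℤ}
    (hu : IsUnit (a * d - b * c)) (hp : p' = (a : ℝ) • p + (b : ℝ) • q)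
    (hq : q' = (c : ℝ) • p + (d : ℝ) • q) :
    ∃ h' : wedge p' q' ≠ 0, latticeMk p' q' h' = latticeMk p q h := by
  subst hp hq
  have h' : wedge ((a : ℝ) • p + (b : ℝ) • q) ((c : ℝ) • p + (d : ℝ) • q) ≠ 0 := by
    rw [wedge_comb]
    refine mul_ne_zero ?_ h
    exact_mod_cast hu.ne_zero
  refine ⟨h', ?_⟩
  symm
  refine QuotientGroup.eq.2 ?_
  have hγ : IsUnit (!![a, c; b, d] : Matrix (Fin 2) (Fin 2) ℤ).det := by
    rw [Matrix.det_fin_two_of, mul_comm c b]; exact hu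
  obtain ⟨γ, hγ'⟩ := (Matrix.isUnit_iff_isUnit_det _).2 hγ
  refine ⟨γ, ?_⟩
  rw [eq_inv_mul_iff_mul_eq]
  apply Units.ext
  have e : ((Matrix.GeneralLinearGroup.map (Int.castRingHom ℝ) γ : GL (Fin 2) ℝ) :
      Matrix (Fin 2) (Fin 2) ℝ) = !![(a : ℝ), c; b, d] := by
    ext i j
    rw [Matrix.GeneralLinearGroup.map_apply, hγ']
    fin_cases i <;> fin_cases j <;> rfl
  rw [Units.val_mul, e, columnsGL_val, columnsGL_val, Matrix.mul_fin_two]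
  ext i j
  fin_cases i <;> fin_cases j <;> simp <;> ring

theorem comb_eq_zero_iff {p q : Plane} (h : wedge p q ≠ 0) (a b : ℝ) :
    a • p + b • q = 0 ↔ a = 0 ∧ b = 0 := by
  constructor
  · intro e
    have h1 := wedge_comb_right p q p a b
    have h2 := wedge_comb_right p q q a b
    rw [e, wedge_self] at h1 h2
    rw [wedge_swap p q] at h2
    simp only [wedge, Pi.zero_apply, mul_zero, sub_self, zero_add] at h1 h2
    simp only [wedge] at h
    constructor
    · by_contra ha; exact (mul_ne_zero ha h) (by linarith)
    · by_contra hb; exact (mul_ne_zero hb h) (by linarith)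
  · rintro ⟨rfl, rfl⟩; simp

theorem comb_inj {p q : Plane} (h : wedge p q ≠ 0) {a b c d : ℝ}
    (e : a • p + b • q = c • p + d • q) : a = c ∧ b = d := by
  have : (a - c) • p + (b - d) • q = 0 := by
    rw [sub_smul, sub_smul]
    calc _ = (a • p + b • q) - (c • p + d • q) := by abel
      _ = 0 := by rw [e, sub_self]
  obtain ⟨h1, h2⟩ := (comb_eq_zero_iff h _ _).1 this
  exact ⟨sub_eq_zero.1 h1, sub_eq_zero.1 h2⟩

theorem isAdmissible_latticeMk {K : Set Plane} (hK : IsSymmConvexDomain K) {p q : Plane}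
    (h : wedge p q ≠ 0) : IsAdmissible K (latticeMk p q h) ↔
      ∀ a b : ℤ, ¬ (a = 0 ∧ b = 0) → 1 ≤ gauge K ((a : ℝ) • p + (b : ℝ) • q) := by
  unfold IsAdmissible
  constructor
  · intro hL a b hab
    rw [hK.one_le_gauge_iff]
    intro hmem
    have : (a : ℝ) • p + (b : ℝ) • q ∈ (latticeMk p q h).points ∩ K :=
      ⟨(mem_points_latticeMk h _).2 ⟨a, b, rfl⟩, hmem⟩
    rw [hL, Set.mem_singleton_iff, comb_eq_zero_iff h] at this
    exact hab (by exact_mod_cast this)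
  · intro hL
    ext x
    constructor
    · rintro ⟨hx, hxK⟩
      obtain ⟨a, b, rfl⟩ := (mem_points_latticeMk h _).1 hx
      by_contra hne
      have := hL a b (by rintro ⟨rfl, rfl⟩; exact hne (by simp))
      exact (hK.one_le_gauge_iff _).1 this hxK
    · rintro rfl
      exact ⟨(mem_points_latticeMk h _).2 ⟨0, 0, by simp⟩, hK.zero_mem⟩

/-! ### Inscribed hexagons and the critical determinant -/

/-- The points `p`, `q`, `q - p` lie on the boundary of `K` and `(p, q)` is positively oriented, so
that `± p, ± q, ± (q - p)` are the vertices of an affinely regular hexagon inscribed in `K`. The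
boundary of `K` is expressed through its Minkowski gauge. -/
structure IsInscribedHexagon (K : Set Plane) (p q : Plane) : Prop where
  left : gauge K p = 1
  right : gauge K q = 1
  diff : gauge K (q - p) = 1
  pos : 0 < wedge p q

/-- An inscribed hexagon whose lattice has covolume `Δ(K)`. -/
structure IsCriticalHexagon (K : Set Plane) (p q : Plane) : Prop extends
    IsInscribedHexagon K p q where
  wedge_eq : wedge p q = criticalDet K

/-- Turning an inscribed hexagon by one vertex. -/
theorem IsInscribedHexagon.next {K : Set Plane} (hK : IsSymmConvexDomain K) {p q : Plane}
    (h : IsInscribedHexagon K p q) : IsInscribedHexagon K q (q - p) where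
  left := h.right
  right := h.diff
  diff := by rw [sub_sub_cancel_left, hK.gauge_neg, h.left]
  pos := by rw [wedge_sub_right, wedge_self, wedge_swap p q]; linarith [h.pos]

namespace IsSymmConvexDomain

variable {K : Set Plane} (hK : IsSymmConvexDomain K)

include hK

/-- In the cone over `p` and `q` the norm is bounded below through `(a + b) p = v - b (q - p)`,
where `v = a p + b q`. -/
theorem le_gauge_comb_left {p q : Plane} {s a b : ℝ} (hp : 1 ≤ gauge K p)
    (hr : gauge K (q - p) ≤ s) (ha : 0 ≤ a) (hb : 0 ≤ b) :
    a + b - b * s ≤ gauge K (a • p + b • q) := by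
  have h1 : (a + b) • p = (1 : ℝ) • (a • p + b • q) + (-b) • (q - p) := by module
  have h2 := hK.gauge_comb 1 (-b) (a • p + b • q) (q - p)
  rw [← h1, hK.gauge_smul, abs_one, abs_neg, abs_of_nonneg hb, abs_of_nonneg (by linarith)] at h2
  nlinarith

theorem le_gauge_comb_right {p q : Plane} {s a b : ℝ} (hq : 1 ≤ gauge K q)
    (hr : gauge K (q - p) ≤ s) (ha : 0 ≤ a) (hb : 0 ≤ b) :
    a + b - a * s ≤ gauge K (a • p + b • q) := by
  have := hK.le_gauge_comb_left (p := q) (q := p) (s := s) hq (by rwa [hK.gauge_sub_comm]) hb ha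
  rw [add_comm (a • p), add_comm a]; exact this

theorem le_gauge_int_comb_of_nonneg {p q : Plane} {s : ℝ} (hp : 1 ≤ gauge K p)
    (hq : 1 ≤ gauge K q) (hr : gauge K (q - p) ≤ s) (hs1 : 1 ≤ s) (hs : s ≤ 2) {a b : ℤ}
    (ha : 0 ≤ a) (hb : 0 ≤ b) (hab : ¬ (a = 0 ∧ b = 0)) :
    2 - s ≤ gauge K ((a : ℝ) • p + (b : ℝ) • q) := by
  have ha' : (0 : ℝ) ≤ a := by exact_mod_cast ha
  have hb' : (0 : ℝ) ≤ b := by exact_mod_cast hb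
  rcases le_total a b with h | h
  · have h1 : (1 : ℝ) ≤ b := by exact_mod_cast (by omega : (1 : ℤ) ≤ b)
    have h2 : (a : ℝ) ≤ b := by exact_mod_cast h
    have := hK.le_gauge_comb_right hq hr ha' hb'
    nlinarith
  · have h1 : (1 : ℝ) ≤ a := by exact_mod_cast (by omega : (1 : ℤ) ≤ a)
    have h2 : (b : ℝ) ≤ a := by exact_mod_cast h
    have := hK.le_gauge_comb_left hp hr ha' hb'
    nlinarith

/-- If the norms of `p`, `q`, `q - p` lie in `[1, s]`, then every nonzero vector of the lattice
they generate has norm at least `2 - s`. The six cones spanned by consecutive vectors among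
`± p, ± q, ± (q - p)` cover the plane. -/
theorem le_gauge_int_comb {p q : Plane} {s : ℝ} (hp : 1 ≤ gauge K p)
    (hq : 1 ≤ gauge K q) (hr : 1 ≤ gauge K (q - p)) (hp' : gauge K p ≤ s) (hq' : gauge K q ≤ s)
    (hr' : gauge K (q - p) ≤ s) (hs : s ≤ 2) {a b : ℤ} (hab : ¬ (a = 0 ∧ b = 0)) :
    2 - s ≤ gauge K ((a : ℝ) • p + (b : ℝ) • q) := by
  -- up to sign the second coordinate is nonnegative
  wlog hb : 0 ≤ b generalizing a b
  · have := this (a := -a) (b := -b) (by omega) (by omega)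
    rw [← hK.gauge_neg]
    convert this using 2
    push_cast; module
  have hs1 : 1 ≤ s := hp.trans hp'
  rcases le_total 0 a with ha | ha
  · exact hK.le_gauge_int_comb_of_nonneg hp hq hr' hs1 hs ha hb hab
  rcases le_total 0 (a + b) with hc | hc
  · have := hK.le_gauge_int_comb_of_nonneg (p := q) (q := q - p) (s := s) hq hr
      (by rwa [sub_sub_cancel_left, hK.gauge_neg]) hs1 hs hc (b := -a) (by omega) (by omega)
    convert this using 2
    push_cast; module
  · have := hK.le_gauge_int_comb_of_nonneg (p := q - p) (q := -p) (s := s) hr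
      (by rwa [hK.gauge_neg]) (by rwa [show -p - (q - p) = -q by abel, hK.gauge_neg]) hs1 hs hb
      (b := -(a + b)) (by omega) (by omega)
    convert this using 2
    push_cast; module

theorem isAdmissible_of_hexagon {p q : Plane} (h : IsInscribedHexagon K p q) :
    IsAdmissible K (latticeMk p q h.pos.ne') := by
  rw [isAdmissible_latticeMk hK]
  intro a b hab
  have := hK.le_gauge_int_comb h.left.ge h.right.ge h.diff.ge h.left.le h.right.le h.diff.le
    one_le_two hab
  linarith

/-- Every boundary point is a vertex of an inscribed hexagon: by the intermediate value theorem,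
a point `q` running along the boundary from `p` to `-p` takes some time distance one from `p`. -/
theorem exists_hexagon {p : Plane} (hp : gauge K p = 1) : ∃ q, IsInscribedHexagon K p q := by
  set w : Plane := ![-p 1, p 0] with hw
  have hpw : 0 < wedge p w := by
    have : p 0 ≠ 0 ∨ p 1 ≠ 0 := by
      by_contra! h
      exact ne_zero_of_gauge_eq_one hp (by ext i; fin_cases i <;> simp [h.1, h.2])
    simp only [wedge, hw, Matrix.cons_val_zero, Matrix.cons_val_one]
    rcases this with h | h <;> nlinarith [mul_self_pos.2 h, mul_self_nonneg (p 0),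
      mul_self_nonneg (p 1)]
  set u : ℝ → Plane := fun t => (-t) • p + (1 - t ^ 2) • w with hu
  have hu0 : ∀ t, u t ≠ 0 := by
    intro t ht
    obtain ⟨h1, h2⟩ := (comb_eq_zero_iff hpw.ne' _ _).1 ht
    nlinarith
  have hpos : ∀ t, 0 < gauge K (u t) := fun t => hK.gauge_pos (hu0 t)
  have huc : Continuous u := by fun_prop
  set n : ℝ → Plane := fun t => (gauge K (u t))⁻¹ • u t with hn
  have hnc : Continuous n :=
    ((hK.continuous_gauge.comp huc).inv₀ fun t => (hpos t).ne').smul huc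
  have hn1 : ∀ t, gauge K (n t) = 1 := fun t => by
    rw [hn, hK.gauge_smul, abs_of_pos (inv_pos.2 (hpos t)), inv_mul_cancel₀ (hpos t).ne']
  have hf : Continuous fun t => gauge K (n t - p) :=
    hK.continuous_gauge.comp (hnc.sub continuous_const)
  have hm1 : n (-1) = p := by
    have : u (-1) = p := by simp [hu]
    simp only [hn, this, hp, inv_one, one_smul]
  have h1 : n 1 = -p := by
    have : u 1 = -p := by simp [hu]
    simp only [hn, this, hK.gauge_neg, hp, inv_one, one_smul]
  have h2 : gauge K (-p - p) = 2 := by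
    rw [show -p - p = (-2 : ℝ) • p by module, hK.gauge_smul, hp]; norm_num
  obtain ⟨t, ⟨ht1, ht2⟩, ht⟩ := intermediate_value_Icc (by norm_num : (-1 : ℝ) ≤ 1) hf.continuousOn
    (show (1 : ℝ) ∈ Set.Icc (gauge K (n (-1) - p)) (gauge K (n 1 - p)) by
      rw [hm1, h1, h2, sub_self, gauge_zero]; norm_num)
  refine ⟨n t, hp, hn1 t, ht, ?_⟩
  have ht1' : t ≠ -1 := by
    rintro rfl; simp only [hm1, sub_self, gauge_zero, zero_ne_one] at ht
  have ht2' : t ≠ 1 := by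
    rintro rfl; simp only [h1, h2] at ht; norm_num at ht
  have h3 : 0 < 1 - t ^ 2 := by
    have := lt_of_le_of_ne ht1 ht1'.symm
    have := lt_of_le_of_ne ht2 ht2'
    nlinarith
  simp only [hn]
  rw [wedge_smul_right]
  refine mul_pos (inv_pos.2 (hpos t)) ?_
  simp only [hu]
  rw [wedge_comb_right, wedge_self]
  linarith [mul_pos h3 hpw]

/-- Among the lines parallel to a boundary vector `p`, one that is closer to the origin than the
side of an inscribed hexagon meets `K` in a chord longer than `p`, hence meets every lattice coset
`q' + ℤ p` on it. -/
theorem hexagon_wedge_le {p q q' : Plane} (h : IsInscribedHexagon K p q) (hq' : 0 < wedge p q')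
    (hk : ∀ k : ℤ, 1 ≤ gauge K (q' + (k : ℝ) • p)) : wedge p q ≤ wedge p q' := by
  by_contra! hlt
  set s := wedge p q' / wedge p q with hs
  set c := wedge q' q / wedge p q with hc
  have hq : q' = c • p + s • q := eq_comb_of_wedge_ne_zero q' h.pos.ne'
  have hs0 : 0 < s := div_pos hq' h.pos
  have hs1 : s < 1 := (div_lt_one h.pos).2 hlt
  set k : ℤ := ⌈1 - s - c⌉ - 1 with hkdef
  have hk1 : (k : ℝ) < 1 - s - c := by
    have := Int.ceil_lt_add_one (1 - s - c)
    rw [hkdef]; push_cast; linarith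
  have hk2 : -s - c ≤ (k : ℝ) := by
    have := Int.le_ceil (1 - s - c)
    rw [hkdef]; push_cast; linarith
  have hk3 := hk k
  set t := c + k with ht
  have e1 : q' + (k : ℝ) • p = s • q + t • p := by rw [hq, ht]; module
  rw [e1] at hk3
  rcases le_or_gt t 0 with h0 | h0
  · have e2 : s • q + t • p = (s + t) • q + (-t) • (q - p) := by module
    have := hK.gauge_comb (s + t) (-t) q (q - p)
    rw [← e2, h.right, h.diff, abs_of_nonneg (by linarith), abs_of_nonneg (by linarith)] at this
    linarith
  · have := hK.gauge_comb s t q p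
    rw [h.left, h.right, abs_of_pos hs0, abs_of_pos h0] at this
    linarith

theorem exists_abs_wedge_le (w : Plane) : ∃ C > 0, ∀ v, |wedge v w| ≤ C * gauge K v := by
  obtain ⟨C, hC, hCx⟩ := hK.exists_gauge_le_norm
  refine ⟨C * (|w 1| + |w 0| + 1), by positivity, fun v => ?_⟩
  have h0 : |v 0| ≤ C * gauge K v := (norm_le_pi_norm v 0).trans (hCx v)
  have h1 : |v 1| ≤ C * gauge K v := (norm_le_pi_norm v 1).trans (hCx v)
  have h2 : 0 ≤ C * gauge K v := (abs_nonneg _).trans h0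
  calc |wedge v w| ≤ |v 0 * w 1| + |v 1 * w 0| := by
        unfold wedge; exact abs_sub _ _
    _ = |v 0| * |w 1| + |v 1| * |w 0| := by rw [abs_mul, abs_mul]
    _ ≤ C * gauge K v * |w 1| + C * gauge K v * |w 0| := by gcongr
    _ ≤ _ := by nlinarith

/-- Every lattice has a positively oriented basis whose first vector is a shortest nonzero lattice
vector. -/
theorem exists_reduced_basis (L : LatticeSpace) : ∃ p q, ∃ h : 0 < wedge p q,
    latticeMk p q h.ne' = L ∧ ∀ x ∈ L.points, x ≠ 0 → gauge K p ≤ gauge K x := by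
  obtain ⟨g₁, g₂, hg, rfl⟩ := exists_latticeMk L
  set N : ℤ × ℤ → ℝ := fun z => gauge K ((z.1 : ℝ) • g₁ + (z.2 : ℝ) • g₂) with hN
  set S : Set (ℤ × ℤ) := {z | z ≠ 0 ∧ N z ≤ N (1, 0)} with hS
  have hfin : S.Finite := by
    obtain ⟨C, hC, hCx⟩ := hK.exists_abs_wedge_le g₂
    obtain ⟨D, hD, hDx⟩ := hK.exists_abs_wedge_le g₁
    set A := C * N (1, 0) / |wedge g₁ g₂|
    set B := D * N (1, 0) / |wedge g₁ g₂|
    refine ((Set.finite_Icc (⌈-A⌉) ⌊A⌋).prod (Set.finite_Icc (⌈-B⌉) ⌊B⌋)).subset ?_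
    rintro ⟨a, b⟩ ⟨-, hz⟩
    have hpos := abs_pos.2 hg
    have ha : |(a : ℝ)| ≤ A := by
      rw [le_div_iff₀ hpos, ← abs_mul]
      refine le_trans (le_of_eq ?_) ((hCx _).trans (mul_le_mul_of_nonneg_left hz hC.le))
      rw [wedge_comb_left, wedge_self]; simp
    have hb : |(b : ℝ)| ≤ B := by
      rw [le_div_iff₀ hpos, ← abs_mul]
      refine le_trans (le_of_eq ?_) ((hDx _).trans (mul_le_mul_of_nonneg_left hz hD.le))
      rw [wedge_comb_left, wedge_self, wedge_swap g₁ g₂]; simp [abs_mul]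
    rw [abs_le] at ha hb
    exact ⟨⟨Int.ceil_le.2 ha.1, Int.le_floor.2 ha.2⟩, ⟨Int.ceil_le.2 hb.1, Int.le_floor.2 hb.2⟩⟩
  obtain ⟨z, ⟨hz0, hz1⟩, hzmin⟩ := Set.exists_min_image S N hfin ⟨(1, 0), by simp, le_rfl⟩
  obtain ⟨a, b⟩ := z
  have hmin : ∀ c d : ℤ, ¬ (c = 0 ∧ d = 0) → N (a, b) ≤ N (c, d) := by
    intro c d hcd
    rcases le_total (N (c, d)) (N (1, 0)) with h | h
    · exact hzmin (c, d) ⟨by simpa [Prod.ext_iff] using hcd, h⟩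
    · exact hz1.trans h
  have hpos : 0 < N (a, b) := by
    refine hK.gauge_pos fun e => hz0 ?_
    obtain ⟨h1, h2⟩ := (comb_eq_zero_iff hg _ _).1 e
    simp only at h1 h2
    ext
    · exact_mod_cast h1
    · exact_mod_cast h2
  -- a shortest vector is primitive
  have hcop : IsCoprime a b := by
    rw [Int.isCoprime_iff_gcd_eq_one]
    obtain ⟨a', ha'⟩ := Int.gcd_dvd_left a b
    obtain ⟨b', hb'⟩ := Int.gcd_dvd_right a b
    set d := Int.gcd a b with hd
    have hd0 : d ≠ 0 := by
      rw [hd, Ne, Int.gcd_eq_zero_iff]; rintro ⟨rfl, rfl⟩; exact hz0 rfl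
    have h1 : N (a, b) = d * N (a', b') := by
      have : (a : ℝ) • g₁ + (b : ℝ) • g₂ = (d : ℝ) • ((a' : ℝ) • g₁ + (b' : ℝ) • g₂) := by
        rw [ha', hb']; push_cast; module
      simp only [hN, this, hK.gauge_smul, Nat.abs_cast]
    have h2 : ¬ (a' = 0 ∧ b' = 0) := by
      rintro ⟨rfl, rfl⟩
      simp only [mul_zero] at ha' hb'
      exact hz0 (by ext <;> assumption)
    have h3 := hmin a' b' h2
    by_contra hne
    have h4 : (2 : ℝ) ≤ d := by exact_mod_cast (by omega : 2 ≤ d)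
    nlinarith
  obtain ⟨u, v, huv⟩ := hcop
  set p := (a : ℝ) • g₁ + (b : ℝ) • g₂ with hp
  have hpmin : ∀ x ∈ (latticeMk g₁ g₂ hg).points, x ≠ 0 → gauge K p ≤ gauge K x := by
    intro x hx hx0
    obtain ⟨c, d, rfl⟩ := (mem_points_latticeMk hg x).1 hx
    exact hmin c d (by rintro ⟨rfl, rfl⟩; simp at hx0)
  obtain ⟨h', hL⟩ := latticeMk_eq_of_unimodular hg (a := a) (b := b) (c := -v) (d := u)
    (by rw [show a * u - b * -v = 1 by linarith]; exact isUnit_one) hp rfl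
  rcases lt_or_gt_of_ne h' with hneg | hpos'
  · obtain ⟨h'', hL'⟩ := latticeMk_eq_of_unimodular hg (a := a) (b := b) (c := v) (d := -u)
      (by rw [show a * -u - b * v = -1 by linarith]; exact isUnit_one.neg) hp rfl
    refine ⟨p, _, ?_, hL', hpmin⟩
    rw [wedge_comb] at hneg ⊢
    push_cast at hneg ⊢
    linarith
  · exact ⟨p, _, hpos', hL, hpmin⟩

/-- An admissible lattice has a basis `(p, q)` with `p` shortest, of norm `m ≥ 1`, and its
covolume is at least `m²` times that of any inscribed hexagon at `p / m`. -/
theorem exists_reduced_basis_of_isAdmissible {L : LatticeSpace} (hL : IsAdmissible K L) :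
    ∃ p q m, ∃ h : 0 < wedge p q, latticeMk p q h.ne' = L ∧ 1 ≤ m ∧ gauge K p = m ∧
      ∀ q', IsInscribedHexagon K (m⁻¹ • p) q' → m ^ 2 * wedge (m⁻¹ • p) q' ≤ wedge p q := by
  obtain ⟨p, q, h, rfl, hmin⟩ := hK.exists_reduced_basis L
  have hadm := (isAdmissible_latticeMk hK h.ne').1 hL
  have hm : 1 ≤ gauge K p := by simpa using hadm 1 0 (by simp)
  refine ⟨p, q, gauge K p, h, rfl, hm, rfl, fun q' hq' => ?_⟩
  set m := gauge K p
  have hm0 : 0 < m := by linarith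
  have := hK.hexagon_wedge_le hq' (q' := m⁻¹ • q) (by
    rw [wedge_smul_left, wedge_smul_right]; positivity) (fun k => by
    have h1 : m⁻¹ • q + (k : ℝ) • m⁻¹ • p = m⁻¹ • (q + (k : ℝ) • p) := by module
    rw [h1, hK.gauge_smul, abs_of_pos (inv_pos.2 hm0), ← div_eq_inv_mul, le_div_iff₀ hm0, one_mul]
    refine hmin _ ((mem_points_latticeMk _ _).2 ⟨k, 1, by push_cast; module⟩) ?_
    intro h0
    have := (comb_eq_zero_iff h.ne' (k : ℝ) 1).1 (by rw [← h0]; module)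
    exact one_ne_zero this.2)
  calc m ^ 2 * wedge (m⁻¹ • p) q' ≤ m ^ 2 * wedge (m⁻¹ • p) (m⁻¹ • q) := by gcongr
    _ = wedge p q := by rw [wedge_smul_left, wedge_smul_right]; field_simp

theorem gauge_normalize {p : Plane} (hp : p ≠ 0) : gauge K ((gauge K p)⁻¹ • p) = 1 := by
  have := hK.gauge_pos hp
  rw [hK.gauge_smul, abs_of_pos (inv_pos.2 this), inv_mul_cancel₀ this.ne']

theorem exists_hexagon_le_covol {L : LatticeSpace} (hL : IsAdmissible K L) :
    ∃ p q, IsInscribedHexagon K p q ∧ wedge p q ≤ L.covol := by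
  obtain ⟨p, q, m, h, rfl, hm1, hm, hle⟩ := hK.exists_reduced_basis_of_isAdmissible hL
  have hp : gauge K (m⁻¹ • p) = 1 := by
    rw [← hm]; exact hK.gauge_normalize (by rintro rfl; simp at hm; linarith)
  obtain ⟨q', hq'⟩ := hK.exists_hexagon hp
  refine ⟨_, q', hq', ?_⟩
  rw [covol_latticeMk, abs_of_pos h]
  have := hle q' hq'
  nlinarith [hq'.pos,
    mul_nonneg (mul_nonneg (sub_nonneg.2 hm1) (by linarith : 0 ≤ m + 1)) hq'.pos.le]

theorem isCompact_hexagons :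
    IsCompact {x : Plane × Plane |
      gauge K x.1 = 1 ∧ gauge K x.2 = 1 ∧ gauge K (x.2 - x.1) = 1} := by
  refine (hK.isCompact_gauge_le_one.prod hK.isCompact_gauge_le_one).of_isClosed_subset ?_ ?_
  · have := hK.continuous_gauge
    exact (isClosed_eq (by fun_prop) continuous_const).inter
      ((isClosed_eq (by fun_prop) continuous_const).inter
        (isClosed_eq (by fun_prop) continuous_const))
  · rintro x ⟨h1, h2, -⟩
    exact ⟨h1.le, h2.le⟩

theorem exists_min_hexagon : ∃ p q, IsInscribedHexagon K p q ∧
    ∀ p' q', IsInscribedHexagon K p' q' → wedge p q ≤ wedge p' q' := by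
  obtain ⟨x, hx⟩ : ∃ x : Plane, x ≠ 0 := exists_ne 0
  obtain ⟨q₀, hq₀⟩ := hK.exists_hexagon (hK.gauge_normalize hx)
  obtain ⟨⟨p, q⟩, ⟨h1, h2, h3⟩, hmin⟩ := hK.isCompact_hexagons.exists_isMinOn
    ⟨(_, q₀), hq₀.left, hq₀.right, hq₀.diff⟩ continuous_wedge.abs.continuousOn
  simp only at h1 h2 h3
  have hmin' : ∀ p' q', IsInscribedHexagon K p' q' → |wedge p q| ≤ wedge p' q' := by
    intro p' q' h
    have := hmin (show (p', q') ∈ _ from ⟨h.left, h.right, h.diff⟩)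
    simp only [Set.mem_ofPred_eq] at this
    rwa [abs_of_pos h.pos] at this
  rcases lt_or_gt_of_ne (hK.wedge_ne_zero h1 h2 h3) with h | h
  · refine ⟨q, p, ⟨h2, h1, by rw [hK.gauge_sub_comm]; exact h3,
      by rw [wedge_swap p q]; linarith⟩, ?_⟩
    intro p' q' h'
    rw [wedge_swap p q, ← abs_of_neg h]; exact hmin' _ _ h'
  · exact ⟨p, q, ⟨h1, h2, h3, h⟩, by rwa [abs_of_pos h] at hmin'⟩

/-- The critical determinant is attained by an inscribed hexagon. -/
theorem exists_criticalHexagon : ∃ p q, IsCriticalHexagon K p q := by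
  obtain ⟨p, q, h, hmin⟩ := hK.exists_min_hexagon
  refine ⟨p, q, h, ?_⟩
  have hleast : IsLeast {d : ℝ | ∃ L : LatticeSpace, IsAdmissible K L ∧ L.covol = d}
      (wedge p q) := by
    constructor
    · exact ⟨_, hK.isAdmissible_of_hexagon h, by rw [covol_latticeMk, abs_of_pos h.pos]⟩
    · rintro d ⟨L, hL, rfl⟩
      obtain ⟨p', q', h', hle⟩ := hK.exists_hexagon_le_covol hL
      exact (hmin _ _ h').trans hle
  exact hleast.csInf_eq.symm

theorem criticalDet_pos : 0 < criticalDet K := by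
  obtain ⟨p, q, h⟩ := hK.exists_criticalHexagon
  rw [← h.wedge_eq]; exact h.pos

end IsSymmConvexDomain

theorem criticalDet_le_covol {K : Set Plane} {L : LatticeSpace} (hL : IsAdmissible K L) :
    criticalDet K ≤ L.covol := by
  refine csInf_le ⟨0, ?_⟩ ⟨L, hL, rfl⟩
  rintro d ⟨L', -, rfl⟩
  obtain ⟨p, q, h, rfl⟩ := exists_latticeMk L'
  rw [covol_latticeMk]; exact abs_nonneg _

namespace IsSymmConvexDomain

variable {K : Set Plane} (hK : IsSymmConvexDomain K)

include hK

theorem criticalDet_le_wedge {p q : Plane} (h : IsInscribedHexagon K p q) :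
    criticalDet K ≤ wedge p q := by
  have := criticalDet_le_covol (hK.isAdmissible_of_hexagon h)
  rwa [covol_latticeMk, abs_of_pos h.pos] at this

theorem isAdmissible_anti {K' : Set Plane} (h : K ⊆ K') {L : LatticeSpace}
    (hL : IsAdmissible K' L) : IsAdmissible K L := by
  have h0 : (0 : Plane) ∈ L.points ∩ K' := hL ▸ Set.mem_singleton 0
  refine Set.Subset.antisymm (fun x hx => hL ▸ ⟨hx.1, h hx.2⟩) ?_
  rintro x rfl
  exact ⟨h0.1, hK.zero_mem⟩

theorem criticalDet_mono {K' : Set Plane} (hK' : IsSymmConvexDomain K') (h : K ⊆ K') :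
    criticalDet K ≤ criticalDet K' := by
  obtain ⟨p, q, hpq⟩ := hK'.exists_criticalHexagon
  have := criticalDet_le_covol (hK.isAdmissible_anti h (hK'.isAdmissible_of_hexagon hpq.1))
  rwa [covol_latticeMk, abs_of_pos hpq.pos, hpq.wedge_eq] at this

end IsSymmConvexDomain

/-! ### Critical hexagons of domains that are not parallelograms -/

namespace IsSymmConvexDomain

variable {K : Set Plane} (hK : IsSymmConvexDomain K)

include hK

/-- A supporting functional at a boundary point. -/
theorem exists_support {p : Plane} (hp : gauge K p = 1) :
    ∃ c : Plane →ₗ[ℝ] ℝ, c p = 1 ∧ ∀ x, |c x| ≤ gauge K x := by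
  obtain ⟨f, hf⟩ := geometric_hahn_banach_open_point hK.convex hK.isOpen
    ((hK.one_le_gauge_iff p).1 hp.ge)
  have hfp : 0 < f p := by simpa using hf 0 hK.zero_mem
  have h1 : ∀ x, f x ≤ gauge K x * f p := by
    intro x
    rcases eq_or_ne x 0 with rfl | hx
    · simp
    refine le_of_forall_gt_imp_ge_of_dense fun a ha => ?_
    have hx0 := hK.gauge_pos hx
    have ha0 : 0 < a / f p := div_pos ((mul_pos hx0 hfp).trans ha) hfp
    have h2 : (a / f p)⁻¹ • x ∈ K := by
      rw [← hK.gauge_lt_one_iff, hK.gauge_smul, abs_of_pos (inv_pos.2 ha0), ← div_eq_inv_mul,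
        div_lt_one ha0, lt_div_iff₀ hfp]
      exact ha
    have h3 := hf _ h2
    rw [map_smul, smul_eq_mul, ← div_eq_inv_mul, div_lt_iff₀ ha0, mul_div_cancel₀ _ hfp.ne'] at h3
    exact h3.le
  refine ⟨(f p)⁻¹ • (f : Plane →ₗ[ℝ] ℝ), by simp [hfp.ne'], fun x => ?_⟩
  have h2 := h1 x
  have h3 := h1 (-x)
  rw [hK.gauge_neg, map_neg] at h3
  simp only [LinearMap.smul_apply, ContinuousLinearMap.coe_coe, smul_eq_mul, ← div_eq_inv_mul,
    abs_div, abs_of_pos hfp, div_le_iff₀ hfp, abs_le]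
  constructor <;> linarith

/-- If a parallelogram `{a p + b v : |a|, |b| < 1}` circumscribed about `K` has a vertex `p + v`
outside the closure of `K`, then the lattice with basis `p - η v`, `v - η p`, for small `η > 0`, is
admissible: its only vectors inside the parallelogram are `± (1 - η) (p + v)`. -/
theorem criticalDet_lt_of_vertex {p v : Plane} (hpv : wedge p v ≠ 0)
    (hN : ∀ a b : ℝ, max |a| |b| ≤ gauge K (a • p + b • v)) (hv : 1 < gauge K (p + v)) :
    criticalDet K < |wedge p v| := by
  set N := gauge K (p + v) with hNdef
  set η := min (1 / 2) (1 - 1 / N) with hη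
  have hη1 : η ≤ 1 / 2 := min_le_left _ _
  have hη2 : η ≤ 1 - 1 / N := min_le_right _ _
  have hη0 : 0 < η := by
    refine lt_min (by norm_num) ?_
    rw [sub_pos, div_lt_one (by linarith)]; exact hv
  have hηN : 1 ≤ (1 - η) * N := by
    have h1 : 1 / N ≤ 1 - η := by linarith
    rwa [div_le_iff₀ (by linarith)] at h1
  set A := (1 : ℝ) • p + (-η) • v
  set B := (-η) • p + (1 : ℝ) • v
  have hAB : wedge A B = (1 - η ^ 2) * wedge p v := by rw [wedge_comb]; ring
  have hlt : 0 < 1 - η ^ 2 := by nlinarith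
  have hAB0 : wedge A B ≠ 0 := by rw [hAB]; exact mul_ne_zero hlt.ne' hpv
  have hadm : IsAdmissible K (latticeMk A B hAB0) := by
    rw [isAdmissible_latticeMk hK]
    intro m n hmn
    -- up to sign the first coefficient is nonnegative
    wlog hm : 0 ≤ m generalizing m n
    · have := this (-m) (-n) (by omega) (by omega)
      rw [← hK.gauge_neg]
      convert this using 2
      push_cast; module
    have e : (m : ℝ) • A + (n : ℝ) • B = (m - η * n) • p + (n - η * m) • v := by
      simp only [A, B]; module
    have hm' : (0 : ℝ) ≤ m := by exact_mod_cast hm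
    have h1 := (le_max_left _ _).trans (hN (m - η * n) (n - η * m))
    have h2 := (le_max_right _ _).trans (hN (m - η * n) (n - η * m))
    rw [← e] at h1 h2
    have h1' := (le_abs_self _).trans h1
    have h2' := (le_abs_self _).trans h2
    have h2'' := (neg_le_abs _).trans h2
    rcases le_or_gt n 0 with hn | hn
    · have hn' : (n : ℝ) ≤ 0 := by exact_mod_cast hn
      rcases eq_or_lt_of_le hm with h0 | h0
      · have h3 : (n : ℝ) ≤ -1 := by exact_mod_cast (by omega : n ≤ -1)
        nlinarith
      · have h3 : (1 : ℝ) ≤ m := by exact_mod_cast (by omega : 1 ≤ m)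
        nlinarith
    · have hn' : (1 : ℝ) ≤ n := by exact_mod_cast (by omega : 1 ≤ n)
      by_cases h11 : m = 1 ∧ n = 1
      · obtain ⟨rfl, rfl⟩ := h11
        have e' : ((1 : ℤ) : ℝ) • A + ((1 : ℤ) : ℝ) • B = (1 - η) • (p + v) := by
          simp only [A, B]; push_cast; module
        rw [e', hK.gauge_smul, abs_of_nonneg (by linarith)]
        exact hηN
      · rcases le_total n m with h | h
        · have h3 : (2 : ℝ) ≤ m := by exact_mod_cast (by omega : 2 ≤ m)
          have h4 : (n : ℝ) ≤ m := by exact_mod_cast h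
          nlinarith
        · have h4 : (m : ℝ) ≤ n := by exact_mod_cast h
          rcases eq_or_lt_of_le hm with rfl | h0
          · exact hn'.trans (by simpa only [Int.cast_zero, mul_zero, sub_zero] using h2')
          · have h3 : (2 : ℝ) ≤ n := by exact_mod_cast (by omega : 2 ≤ n)
            nlinarith
  have h1 := criticalDet_le_covol hadm
  rw [covol_latticeMk, hAB, abs_mul, abs_of_pos hlt] at h1
  have h2 := mul_pos (pow_pos hη0 2) (abs_pos.2 hpv)
  linarith

/-- Unless `K` is a parallelogram, the line at height `Δ(K)` above a boundary vector meets `K`.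
Otherwise this line and a supporting line at `p` bound a circumscribed parallelogram of critical
determinant `Δ(K)`, and `K` must fill it. -/
theorem exists_gauge_line_lt_one (hKp : ¬ IsParallelogram K) {p q : Plane} (hp : gauge K p = 1)
    (hpq : wedge p q = criticalDet K) : ∃ t : ℝ, gauge K (q + t • p) < 1 := by
  by_contra! hline
  have hΔ := hK.criticalDet_pos
  obtain ⟨c, hcp, hc⟩ := hK.exists_support hp
  set v := q - c q • p with hv
  have hpv : wedge p v = criticalDet K := by
    rw [hv, wedge_sub_right, wedge_smul_right, wedge_self, hpq]; ring
  have hcv : c v = 0 := by rw [hv, map_sub, map_smul, hcp, smul_eq_mul, mul_one, sub_self]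
  have hN : ∀ a b : ℝ, max |a| |b| ≤ gauge K (a • p + b • v) := by
    intro a b
    refine max_le ?_ ?_
    · simpa [hcp, hcv] using hc (a • p + b • v)
    · rcases eq_or_ne b 0 with rfl | hb
      · simpa using gauge_nonneg _
      · have e : a • p + b • v = b • (q + (a / b - c q) • p) := by
          rw [hv, smul_add, smul_smul, mul_sub, mul_div_cancel₀ _ hb]; module
        rw [e, hK.gauge_smul]
        exact le_mul_of_one_le_right (abs_nonneg b) (hline _)
  have hvert1 : gauge K (p + v) ≤ 1 := by
    by_contra! h
    have := hK.criticalDet_lt_of_vertex (by rw [hpv]; exact hΔ.ne') hN h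
    rw [hpv, abs_of_pos hΔ] at this
    exact lt_irrefl _ this
  have hvert2 : gauge K (p - v) ≤ 1 := by
    by_contra! h
    have := hK.criticalDet_lt_of_vertex (p := p) (v := -v)
      (by rw [wedge_neg_right, hpv]; exact neg_ne_zero.2 hΔ.ne')
      (fun a b => by simpa using hN a (-b)) (by rwa [← sub_eq_add_neg])
    rw [wedge_neg_right, hpv, abs_neg, abs_of_pos hΔ] at this
    exact lt_irrefl _ this
  refine hKp ⟨0, p, v, ?_, ?_⟩
  · rw [LinearIndependent.pair_iff]
    exact fun s t h => (comb_eq_zero_iff (by rw [hpv]; exact hΔ.ne') s t).1 h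
  · ext x
    constructor
    · intro hx
      obtain ⟨a, b, rfl⟩ := exists_comb_of_wedge_ne_zero x (by rw [hpv]; exact hΔ.ne')
      have h1 := (hN a b).trans_lt ((hK.gauge_lt_one_iff _).2 hx)
      rw [max_lt_iff, abs_lt, abs_lt] at h1
      exact ⟨a, b, h1.1, h1.2, by rw [zero_add]⟩
    · rintro ⟨a, b, ⟨ha1, ha2⟩, ⟨hb1, hb2⟩, rfl⟩
      rw [← hK.gauge_lt_one_iff]
      have e : 0 + a • p + b • v = ((a + b) / 2) • (p + v) + ((a - b) / 2) • (p - v) := by module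
      have h1 := hK.gauge_comb ((a + b) / 2) ((a - b) / 2) (p + v) (p - v)
      rw [← e] at h1
      have h2 : |(a + b) / 2| * gauge K (p + v) ≤ |(a + b) / 2| :=
        mul_le_of_le_one_right (abs_nonneg _) hvert1
      have h3 : |(a - b) / 2| * gauge K (p - v) ≤ |(a - b) / 2| :=
        mul_le_of_le_one_right (abs_nonneg _) hvert2
      rcases abs_cases ((a + b) / 2) with h | h <;> rcases abs_cases ((a - b) / 2) with h' | h' <;>
        linarith

end IsSymmConvexDomain

namespace IsCriticalHexagon

theorem next {K : Set Plane} (hK : IsSymmConvexDomain K) {p q : Plane}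
    (h : IsCriticalHexagon K p q) : IsCriticalHexagon K q (q - p) where
  toIsInscribedHexagon := h.toIsInscribedHexagon.next hK
  wedge_eq := by rw [wedge_sub_right, wedge_self, wedge_swap p q, zero_sub, neg_neg, h.wedge_eq]

theorem neg {K : Set Plane} (hK : IsSymmConvexDomain K) {p q : Plane}
    (h : IsCriticalHexagon K p q) : IsCriticalHexagon K (-p) (-q) where
  left := by rw [hK.gauge_neg, h.left]
  right := by rw [hK.gauge_neg, h.right]
  diff := by rw [← neg_sub', hK.gauge_neg, h.diff]
  pos := by rw [wedge_neg_left, wedge_neg_right, neg_neg]; exact h.pos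
  wedge_eq := by rw [wedge_neg_left, wedge_neg_right, neg_neg, h.wedge_eq]

theorem next_next {K : Set Plane} (hK : IsSymmConvexDomain K) {p q : Plane}
    (h : IsCriticalHexagon K p q) : IsCriticalHexagon K (q - p) (-p) := by
  have := (h.next hK).next hK
  rwa [sub_sub_cancel_left] at this

theorem prev {K : Set Plane} (hK : IsSymmConvexDomain K) {p q : Plane}
    (h : IsCriticalHexagon K p q) : IsCriticalHexagon K (p - q) p := by
  have := (h.next_next hK).neg hK
  rwa [neg_sub, neg_neg] at this

variable {K : Set Plane} (hK : IsSymmConvexDomain K) (hKp : ¬ IsParallelogram K)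

include hK hKp

section Line

variable {p q : Plane} (h : IsCriticalHexagon K p q)

include h

/-- The line through the side from `q - p` to `q` of a critical hexagon enters `K` between these two
points. -/
theorem exists_gauge_line_lt_one : ∃ t : ℝ, -1 < t ∧ t < 0 ∧ gauge K (q + t • p) < 1 := by
  obtain ⟨t, ht⟩ := hK.exists_gauge_line_lt_one hKp h.left h.wedge_eq
  have e0 : gauge K (q + (0 : ℝ) • p) = 1 := by simp [h.right]
  have e1 : gauge K (q + (-1 : ℝ) • p) = 1 := by
    rw [show q + (-1 : ℝ) • p = q - p by module, h.diff]
  refine ⟨t, ?_, ?_, ht⟩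
  · by_contra! h1
    have := hK.gauge_line_le q p h1 (by norm_num : (-1 : ℝ) ≤ 0)
    rw [e0, e1] at this
    linarith
  · by_contra! h1
    have := hK.gauge_line_le q p (by norm_num : (-1 : ℝ) ≤ 0) h1
    rw [e0, e1] at this
    linarith

theorem gauge_line_lt_one {t : ℝ} (h1 : -1 < t) (h2 : t < 0) : gauge K (q + t • p) < 1 := by
  obtain ⟨s, hs1, hs2, hs⟩ := h.exists_gauge_line_lt_one hK hKp
  have e0 : gauge K (q + (0 : ℝ) • p) = 1 := by simp [h.right]
  have e1 : gauge K (q + (-1 : ℝ) • p) = 1 := by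
    rw [show q + (-1 : ℝ) • p = q - p by module, h.diff]
  rcases le_total t s with hts | hts
  · have := hK.gauge_line_le q p h1.le hts
    rw [e1] at this
    nlinarith
  · have := hK.gauge_line_le q p hts h2.le
    rw [e0] at this
    nlinarith

theorem one_lt_gauge_line_of_pos {t : ℝ} (ht : 0 < t) : 1 < gauge K (q + t • p) := by
  obtain ⟨s, hs1, hs2, hs⟩ := h.exists_gauge_line_lt_one hK hKp
  have e0 : gauge K (q + (0 : ℝ) • p) = 1 := by simp [h.right]
  have := hK.gauge_line_le q p hs2.le ht.le
  rw [e0] at this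
  nlinarith

theorem one_lt_gauge_line_of_lt {t : ℝ} (ht : t < -1) : 1 < gauge K (q + t • p) := by
  obtain ⟨s, hs1, hs2, hs⟩ := h.exists_gauge_line_lt_one hK hKp
  have e1 : gauge K (q + (-1 : ℝ) • p) = 1 := by
    rw [show q + (-1 : ℝ) • p = q - p by module, h.diff]
  have := hK.gauge_line_le q p ht.le hs1.le
  rw [e1] at this
  nlinarith

/-- A critical hexagon is determined by one of its vertices. -/
theorem right_unique {q' : Plane} (h' : IsCriticalHexagon K p q') : q' = q := by
  have hq := eq_comb_of_wedge_ne_zero q' h.pos.ne'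
  rw [h'.wedge_eq, h.wedge_eq, div_self hK.criticalDet_pos.ne', one_smul, add_comm] at hq
  set t := wedge q' q / criticalDet K
  have h1 : ¬ 0 < t := fun ht => by
    have := h.one_lt_gauge_line_of_pos hK hKp ht
    rw [← hq, h'.right] at this; exact lt_irrefl _ this
  have h2 : ¬ t < 0 := fun ht => by
    have e : q' - p = q + (t - 1) • p := by rw [hq]; module
    have := h.one_lt_gauge_line_of_lt hK hKp (t := t - 1) (by linarith)
    rw [← e, h'.diff] at this; exact lt_irrefl _ this
  rw [hq, le_antisymm (not_lt.1 h1) (not_lt.1 h2), zero_smul, add_zero]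

theorem left_unique {p' : Plane} (h' : IsCriticalHexagon K p' q) : p' = p := by
  have := (h.next hK).right_unique hK hKp (h'.next hK)
  exact sub_right_inj.1 this

theorem eq_of_int_comb_nonneg {a b : ℤ} (ha : 0 ≤ a) (hb : 0 ≤ b)
    (hx : gauge K ((a : ℝ) • p + (b : ℝ) • q) = 1) :
    (a : ℝ) • p + (b : ℝ) • q = p ∨ (a : ℝ) • p + (b : ℝ) • q = q := by
  have ha' : (0 : ℝ) ≤ a := by exact_mod_cast ha
  have hb' : (0 : ℝ) ≤ b := by exact_mod_cast hb
  have h1 := hK.le_gauge_comb_left h.left.ge h.diff.le ha' hb'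
  have h2 := hK.le_gauge_comb_right h.right.ge h.diff.le ha' hb'
  have h3 : a ≤ 1 := by
    have : (a : ℝ) ≤ 1 := by linarith
    exact_mod_cast this
  have h4 : b ≤ 1 := by
    have : (b : ℝ) ≤ 1 := by linarith
    exact_mod_cast this
  interval_cases a <;> interval_cases b
  · simp at hx
  · right; simp
  · left; simp
  · exfalso
    have := h.one_lt_gauge_line_of_pos hK hKp one_pos
    rw [one_smul, add_comm] at this
    simp only [Int.cast_one, one_smul] at hx
    exact this.ne' hx

/-- The boundary points of a critical lattice are exactly the six vertices of its hexagon. -/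
theorem eq_vertex {x : Plane} (hx : x ∈ (latticeMk p q h.pos.ne').points) (hx1 : gauge K x = 1) :
    x = p ∨ x = q ∨ x = q - p ∨ x = -p ∨ x = -q ∨ x = p - q := by
  obtain ⟨a, b, rfl⟩ := (mem_points_latticeMk _ _).1 hx
  clear hx
  wlog hb : 0 ≤ b generalizing a b
  · have e : ((-a : ℤ) : ℝ) • p + ((-b : ℤ) : ℝ) • q = -((a : ℝ) • p + (b : ℝ) • q) := by
      push_cast; module
    have := this (-a) (-b) (by rw [e, hK.gauge_neg, hx1]) (by omega)
    rw [e, neg_eq_iff_eq_neg, neg_eq_iff_eq_neg, neg_eq_iff_eq_neg, neg_eq_iff_eq_neg,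
      neg_eq_iff_eq_neg, neg_eq_iff_eq_neg, neg_neg, neg_neg, neg_sub, neg_sub] at this
    tauto
  rcases le_total 0 a with ha | ha
  · have := h.eq_of_int_comb_nonneg hK hKp ha hb hx1
    tauto
  rcases le_total 0 (a + b) with hc | hc
  · have e : (a : ℝ) • p + (b : ℝ) • q = ((a + b : ℤ) : ℝ) • q + ((-a : ℤ) : ℝ) • (q - p) := by
      push_cast; module
    rw [e] at hx1 ⊢
    have := (h.next hK).eq_of_int_comb_nonneg hK hKp hc (by omega : 0 ≤ -a) hx1
    tauto
  · have e : (a : ℝ) • p + (b : ℝ) • q = (b : ℝ) • (q - p) + ((-(a + b) : ℤ) : ℝ) • (-p) := by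
      push_cast; module
    rw [e] at hx1 ⊢
    have := (h.next_next hK).eq_of_int_comb_nonneg hK hKp hb (by omega : 0 ≤ -(a + b)) hx1
    tauto

end Line

end IsCriticalHexagon

/-- The lattice of a critical hexagon is critical. -/
theorem IsCriticalHexagon.mem_criticalLocus {K : Set Plane} (hK : IsSymmConvexDomain K)
    {p q : Plane} (h : IsCriticalHexagon K p q) : latticeMk p q h.pos.ne' ∈ criticalLocus K :=
  ⟨hK.isAdmissible_of_hexagon h.1, by rw [covol_latticeMk, abs_of_pos h.pos, h.wedge_eq]⟩

/-- Every critical lattice is generated by a critical hexagon. -/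
theorem IsSymmConvexDomain.exists_criticalHexagon_of_mem {K : Set Plane}
    (hK : IsSymmConvexDomain K) (hKp : ¬ IsParallelogram K) {L : LatticeSpace}
    (hL : L ∈ criticalLocus K) :
    ∃ p q, ∃ h : IsCriticalHexagon K p q, latticeMk p q h.pos.ne' = L := by
  obtain ⟨hadm, hcov⟩ := hL
  obtain ⟨p, q, m, h, rfl, hm1, hm, hle⟩ := hK.exists_reduced_basis_of_isAdmissible hadm
  rw [covol_latticeMk, abs_of_pos h] at hcov
  have hm0 : (0 : ℝ) < m := by linarith
  have hp : gauge K (m⁻¹ • p) = 1 := by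
    rw [← hm]; exact hK.gauge_normalize (by rintro rfl; simp at hm; linarith)
  obtain ⟨q', hq'⟩ := hK.exists_hexagon hp
  have h1 := hle q' hq'
  have h2 := hK.criticalDet_le_wedge hq'
  have hΔ := hK.criticalDet_pos
  have hm' : m = 1 := by
    refine le_antisymm ?_ hm1
    by_contra! hlt
    have h3 : 1 < m ^ 2 := one_lt_pow₀ hlt two_ne_zero
    have h4 := mul_lt_mul_of_pos_right h3 hq'.pos
    linarith
  subst hm'
  rw [inv_one, one_smul] at hq' h1 h2
  have hcrit : IsCriticalHexagon K p q' := ⟨hq', by linarith⟩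
  -- the lattice points on the line through `q` avoid the open chord, so `q' = q - k p`
  have hq := eq_comb_of_wedge_ne_zero q hq'.pos.ne'
  rw [hcrit.wedge_eq, hcov, div_self hΔ.ne', one_smul, add_comm] at hq
  set a := wedge q q' / criticalDet K
  have e : ((-⌈a⌉ : ℤ) : ℝ) • p + ((1 : ℤ) : ℝ) • q = q' + (a - ⌈a⌉) • p := by
    conv_lhs => rw [hq]
    push_cast; module
  have h3 : a - ⌈a⌉ = 0 := by
    have h4 := Int.le_ceil a
    have h5 := Int.ceil_lt_add_one a
    by_contra hne
    have h6 := hcrit.gauge_line_lt_one hK hKp (t := a - ⌈a⌉) (by linarith)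
      (lt_of_le_of_ne (by linarith) hne)
    rw [← e] at h6
    exact absurd ((isAdmissible_latticeMk hK h.ne').1 hadm _ _ (by simp)) (not_le.2 h6)
  rw [h3, zero_smul, add_zero] at e
  obtain ⟨h', hL⟩ := latticeMk_eq_of_unimodular h.ne' (a := 1) (b := 0) (c := -⌈a⌉) (d := 1)
    (p' := p) (q' := q') (by simp) (by simp) e.symm
  exact ⟨p, q', hcrit, hL⟩

/-! ### Interlacing of critical hexagons -/

/-- The vector `v` lies in the closed convex cone spanned by the positively oriented pair
`(p, q)`. -/
def InCone (p q v : Plane) : Prop := 0 ≤ wedge p v ∧ 0 ≤ wedge v q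

theorem inCone_comb_iff {p q : Plane} (h : 0 < wedge p q) (x y : ℝ) :
    InCone p q (x • p + y • q) ↔ 0 ≤ x ∧ 0 ≤ y := by
  rw [InCone, wedge_comb_right, wedge_comb_left, wedge_self, wedge_self, mul_zero, mul_zero,
    zero_add, add_zero, mul_nonneg_iff_of_pos_right h, mul_nonneg_iff_of_pos_right h, and_comm]

theorem InCone.neg {p q v : Plane} (h : InCone p q v) : InCone (-p) (-q) (-v) := by
  rw [InCone, wedge_neg_left, wedge_neg_right, wedge_neg_left, wedge_neg_right, neg_neg, neg_neg]
  exact h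

/-- The part of the boundary of `K` between two vertices `p`, `q` of an inscribed hexagon lies in
the triangle with vertices `p`, `q`, `p + q`. -/
theorem IsInscribedHexagon.exists_coords {K : Set Plane} (hK : IsSymmConvexDomain K) {p q v : Plane}
    (h : IsInscribedHexagon K p q) (hv : gauge K v = 1) (hc : InCone p q v) :
    ∃ x y : ℝ, v = x • p + y • q ∧ 0 ≤ x ∧ 0 ≤ y ∧ x ≤ 1 ∧ y ≤ 1 ∧ 1 ≤ x + y := by
  obtain ⟨x, y, rfl⟩ := exists_comb_of_wedge_ne_zero v h.pos.ne'
  obtain ⟨hx, hy⟩ := (inCone_comb_iff h.pos x y).1 hc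
  have h1 := hK.le_gauge_comb_left h.left.ge h.diff.le hx hy
  have h2 := hK.le_gauge_comb_right h.right.ge h.diff.le hx hy
  have h3 := hK.gauge_comb x y p q
  rw [hv, abs_of_nonneg hx, abs_of_nonneg hy, h.left, h.right] at h3
  rw [hv] at h1 h2
  exact ⟨x, y, rfl, hx, hy, by linarith, by linarith, by linarith⟩

namespace IsCriticalHexagon

variable {K : Set Plane} (hK : IsSymmConvexDomain K) (hKp : ¬ IsParallelogram K)

include hK hKp

/-- Two consecutive vertices of a critical hexagon never lie in one cone of another critical
hexagon: the triangle on `p, q, p + q` is too small for the determinant to reach `Δ(K)`. -/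
theorem eq_of_inCone {p q v w : Plane} (h : IsCriticalHexagon K p q)
    (h' : IsCriticalHexagon K v w) (hv : InCone p q v) (hw : InCone p q w) : v = p ∧ w = q := by
  obtain ⟨x, y, rfl, hx0, hy0, hx1, hy1, -⟩ := h.exists_coords hK h'.left hv
  obtain ⟨z, t, rfl, hz0, ht0, hz1, ht1, -⟩ := h.exists_coords hK h'.right hw
  have hdet : x * t - y * z = 1 := by
    have := h'.wedge_eq
    rw [wedge_comb, h.wedge_eq] at this
    exact mul_right_cancel₀ hK.criticalDet_pos.ne' (this.trans (one_mul _).symm)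
  have hyz : 0 ≤ y * z := mul_nonneg hy0 hz0
  have hx : x = 1 := by nlinarith
  have ht : t = 1 := by nlinarith
  subst hx ht
  have hyz' : y * z = 0 := by linarith
  rcases mul_eq_zero.1 hyz' with rfl | rfl
  · have e : (1 : ℝ) • p + (0 : ℝ) • q = p := by simp
    rw [e] at h' ⊢
    exact ⟨rfl, h.right_unique hK hKp h'⟩
  · have e : (0 : ℝ) • p + (1 : ℝ) • q = q := by simp
    rw [e] at h' ⊢
    exact ⟨h.left_unique hK hKp h', rfl⟩

/-- Turning two critical hexagons by one vertex each keeps their relative position. -/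
theorem inCone_next {p q v w : Plane} (h : IsCriticalHexagon K p q)
    (h' : IsCriticalHexagon K v w) (hv : InCone p q v) : InCone q (q - p) w := by
  have hpq := h.pos.ne'
  obtain ⟨x, y, hvxy, hx, hy, -⟩ := h.exists_coords hK h'.left hv
  obtain ⟨z, t, hwzt⟩ := exists_comb_of_wedge_ne_zero w hpq
  have hdet : x * t - y * z = 1 := by
    have := h'.wedge_eq
    rw [hvxy, hwzt, wedge_comb, h.wedge_eq] at this
    exact mul_right_cancel₀ hK.criticalDet_pos.ne' (this.trans (one_mul _).symm)
  have hz : z ≤ 0 := by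
    by_contra! hz
    rcases lt_or_ge t 0 with ht | ht
    · nlinarith
    · have hw : InCone p q w := by rw [hwzt, inCone_comb_iff h.pos]; exact ⟨hz.le, ht⟩
      have := (eq_of_inCone hK hKp h h' hv hw).2
      have := (comb_inj hpq (a := z) (b := t) (c := 0) (d := 1) (by rw [← hwzt, this]; module)).1
      linarith
  have hzt : 0 ≤ z + t := by
    by_contra! hzt
    have ew : v - w = (x - z) • p + (y - t) • q := by rw [hvxy, hwzt]; module
    by_cases hyt : t ≤ y
    · -- `v` and its predecessor `v - w` both lie in the cone, so `w` is a vertex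
      obtain ⟨h1, h2⟩ := eq_of_inCone hK hKp h (h'.prev hK)
        (by rw [ew, inCone_comb_iff h.pos]; constructor <;> linarith) hv
      have := comb_inj hpq (a := z) (b := t) (c := -1) (d := 1) (by
        rw [← hwzt, ← h2, ← h1]; module)
      linarith
    · -- `w` and its successor `w - v` both lie in the cone over `q - p` and `-p`
      push Not at hyt
      have hnn := h.next_next hK
      have e1 : w = t • (q - p) + (-(z + t)) • (-p) := by rw [hwzt]; module
      have e2 : w - v = (t - y) • (q - p) + (-(z + t) + (x + y)) • (-p) := by
        rw [hwzt, hvxy]; module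
      have := (eq_of_inCone hK hKp hnn (h'.next hK)
        (by rw [e1, inCone_comb_iff hnn.pos]; constructor <;> linarith)
        (by rw [e2, inCone_comb_iff hnn.pos]; constructor <;> linarith)).1
      have := comb_inj hpq (a := z) (b := t) (c := -1) (d := 1) (by rw [← hwzt, this]; module)
      linarith
  rw [show w = (z + t) • q + (-z) • (q - p) by rw [hwzt]; module,
    inCone_comb_iff (h.next hK).pos]
  exact ⟨hzt, by linarith⟩

theorem inCone_prev {p q v w : Plane} (h : IsCriticalHexagon K p q)
    (h' : IsCriticalHexagon K v w) (hv : InCone p q v) : InCone (p - q) p (v - w) := by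
  have h1 := inCone_next hK hKp h h' hv
  have h2 := (inCone_next hK hKp (h.next hK) (h'.next hK) h1).neg
  rwa [sub_sub_cancel_left, neg_sub, neg_neg, neg_sub] at h2

/-- Among the six vertices of a critical hexagon, one lies in the cone over two consecutive vertices
of any other critical hexagon. -/
theorem exists_vertex_inCone {p q v w : Plane} (h : IsCriticalHexagon K p q)
    (h' : IsCriticalHexagon K v w) : ∃ v' w', ∃ h'' : IsCriticalHexagon K v' w',
      InCone p q v' ∧ latticeMk v' w' h''.pos.ne' = latticeMk v w h'.pos.ne' := by
  -- up to sign, `v` lies on the positive side of `p`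
  wlog hpv : 0 ≤ wedge p v generalizing v w
  · obtain ⟨v', w', h'', h1, h2⟩ := this (h'.neg hK) (by rw [wedge_neg_right]; linarith)
    refine ⟨v', w', h'', h1, h2.trans ?_⟩
    obtain ⟨_, h3⟩ := latticeMk_eq_of_unimodular h'.pos.ne' (a := -1) (b := 0) (c := 0) (d := -1)
      (p' := -v) (q' := -w) (by simp) (by simp) (by simp)
    exact h3
  obtain ⟨x, y, hv⟩ := exists_comb_of_wedge_ne_zero v h.pos.ne'
  have hy : 0 ≤ y := by
    rw [hv, wedge_comb_right, wedge_self, mul_zero, zero_add] at hpv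
    exact (mul_nonneg_iff_of_pos_right h.pos).1 hpv
  rcases le_total 0 x with hx | hx
  · exact ⟨v, w, h', by rw [hv, inCone_comb_iff h.pos]; exact ⟨hx, hy⟩, rfl⟩
  rcases le_total 0 (x + y) with hxy | hxy
  · have h1 : InCone q (q - p) v := by
      rw [show v = (x + y) • q + (-x) • (q - p) by rw [hv]; module, inCone_comb_iff (h.next hK).pos]
      exact ⟨hxy, by linarith⟩
    have h2 := inCone_prev hK hKp (h.next hK) h' h1
    rw [sub_sub_cancel] at h2
    refine ⟨v - w, v, h'.prev hK, h2, ?_⟩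
    obtain ⟨_, h3⟩ := latticeMk_eq_of_unimodular h'.pos.ne' (a := 1) (b := -1) (c := 1) (d := 0)
      (p' := v - w) (q' := v) (by simp) (by push_cast; module) (by simp)
    exact h3
  · have h1 : InCone (q - p) (-p) v := by
      rw [show v = y • (q - p) + (-(x + y)) • (-p) by rw [hv]; module,
        inCone_comb_iff (h.next_next hK).pos]
      exact ⟨hy, by linarith⟩
    have h2 := (inCone_next hK hKp (h.next_next hK) h' h1).neg
    rw [neg_neg, show -(-p - (q - p)) = q by abel] at h2
    refine ⟨-w, -(w - v), (h'.next hK).neg hK, h2, ?_⟩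
    obtain ⟨_, h3⟩ := latticeMk_eq_of_unimodular h'.pos.ne' (a := 0) (b := -1) (c := 1) (d := -1)
      (p' := -w) (q' := -(w - v)) (by simp) (by simp) (by push_cast; module)
    exact h3

/-- A critical lattice has at most one boundary point in the half-open cone from `p` to `q`. -/
theorem eq_of_mem_points_of_inCone {p q v w x : Plane} (h : IsCriticalHexagon K p q)
    (h' : IsCriticalHexagon K v w) (hv : InCone p q v) (hvq : v ≠ q) (hx : InCone p q x)
    (hxq : x ≠ q) (hx1 : gauge K x = 1) (hxL : x ∈ (latticeMk v w h'.pos.ne').points) : x = v := by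
  rcases h'.eq_vertex hK hKp hxL hx1 with rfl | rfl | rfl | rfl | rfl | rfl
  · rfl
  · exact absurd (eq_of_inCone hK hKp h h' hv hx).2 hxq
  · -- then `w = v + x` lies in the cone as well
    have hw : InCone p q w := by
      obtain ⟨h1, h2⟩ := hv
      obtain ⟨h3, h4⟩ := hx
      rw [wedge_sub_right] at h3
      rw [wedge_sub_left] at h4
      exact ⟨by linarith, by linarith⟩
    exact absurd (eq_of_inCone hK hKp h (h'.next hK) hw hx).2 hxq
  · exfalso
    obtain ⟨a, b, rfl⟩ := exists_comb_of_wedge_ne_zero v h.pos.ne'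
    have h1 := (inCone_comb_iff h.pos a b).1 hv
    rw [show -(a • p + b • q) = (-a) • p + (-b) • q by module, inCone_comb_iff h.pos] at hx
    have ha : a = 0 := by linarith
    have hb : b = 0 := by linarith
    exact ne_zero_of_gauge_eq_one h'.left (by rw [ha, hb]; simp)
  · -- then `v - w = v + x` lies in the cone as well
    have hw : InCone p q (v - w) := by
      obtain ⟨h1, h2⟩ := hv
      obtain ⟨h3, h4⟩ := hx
      rw [wedge_neg_right] at h3
      rw [wedge_neg_left] at h4
      exact ⟨by rw [wedge_sub_right]; linarith, by rw [wedge_sub_left]; linarith⟩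
    exact absurd (eq_of_inCone hK hKp h (h'.prev hK) hw hv).2 hvq
  · exact absurd (eq_of_inCone hK hKp h (h'.prev hK) hx hv).2 hvq

end IsCriticalHexagon

/-! ### Boundary arcs of irreducible domains -/

open Filter Topology in
/-- Cutting a pair of small opposite caps off an irreducible domain lowers the critical determinant,
so the critical lattices of the truncated domains have points in the caps. In the limit one obtains
a critical lattice with a point on the face where the functional `c` attains its maximum. -/
theorem IsIrreducibleDomain.exists_criticalHexagon_on_face {K : Set Plane}
    (hKi : IsIrreducibleDomain K) {c : Plane →ₗ[ℝ] ℝ} (hc : ∀ x, |c x| ≤ gauge K x)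
    {x₀ : Plane} (hx₀ : gauge K x₀ = 1) (hcx₀ : c x₀ = 1) :
    ∃ p q, IsCriticalHexagon K p q ∧ c p = 1 := by
  obtain ⟨hK, hirr⟩ := hKi
  have hcc : Continuous c := c.continuous_of_finiteDimensional
  set s : ℕ → ℝ := fun n => 1 - 1 / ((n : ℝ) + 1 + 1) with hs
  have hs0 : ∀ n, 0 < s n := fun n => by
    have : 1 / ((n : ℝ) + 1 + 1) < 1 := by
      rw [div_lt_one (by positivity)]; linarith [Nat.cast_nonneg (α := ℝ) n]
    simp only [hs]; linarith
  have hs1 : ∀ n, s n < 1 := fun n => by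
    have : 0 < 1 / ((n : ℝ) + 1 + 1) := by positivity
    simp only [hs]; linarith
  have hslim : Tendsto s atTop (𝓝 1) := by
    have := (tendsto_one_div_add_atTop_nhds_zero_nat (𝕜 := ℝ)).comp (tendsto_add_atTop_nat 1)
    have h2 := this.const_sub 1
    rw [sub_zero] at h2
    refine h2.congr fun n => ?_
    simp [hs]
  set H : ℕ → Set Plane := fun n => K ∩ {x | |c x| < s n} with hH
  have hHK : ∀ n, IsSymmConvexDomain (H n) := fun n => by
    refine ⟨hK.isOpen.inter (isOpen_lt hcc.abs continuous_const),
      ⟨0, hK.zero_mem, by simpa using hs0 n⟩,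
      hK.convex.inter ?_, hK.isBounded.subset Set.inter_subset_left, ?_⟩
    · rw [show {x | |c x| < s n} = c ⁻¹' Set.Ioo (-s n) (s n) by ext x; simp [abs_lt]]
      exact (convex_Ioo _ _).linear_preimage c
    · rintro x ⟨h1, h2⟩
      exact ⟨hK.symm x h1, by simpa using h2⟩
  have hsub : ∀ n, H n ⊂ K := fun n => by
    refine ⟨Set.inter_subset_left, fun h => ?_⟩
    have h1 : s n • x₀ ∈ K := by
      rw [← hK.gauge_lt_one_iff, hK.gauge_smul, hx₀, mul_one, abs_of_pos (hs0 n)]; exact hs1 n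
    have h2 : |c (s n • x₀)| < s n := (h h1).2
    rw [map_smul, hcx₀, smul_eq_mul, mul_one, abs_of_pos (hs0 n)] at h2
    exact lt_irrefl _ h2
  have hlt : ∀ n, criticalDet (H n) < criticalDet K := fun n => hirr _ (hHK n) (hsub n)
  choose p q hpq using fun n => (hHK n).exists_criticalHexagon
  -- a boundary point of `H n` is a boundary point of `K` or lies on one of the cuts
  have hbd : ∀ n z, gauge (H n) z = 1 → s n ≤ gauge K z ∧ gauge K z ≤ 1 ∧
      (gauge K z ≠ 1 → s n ≤ |c z|) := fun n z hz => by
    have h1 : gauge K z ≤ 1 := hz ▸ (hHK n).gauge_anti (hsub n).1 z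
    have h2 := ((hHK n).one_le_gauge_iff z).1 hz.ge
    have h3 : gauge K z ≠ 1 → s n ≤ |c z| := fun hne => by
      by_contra! h
      exact h2 ⟨(hK.gauge_lt_one_iff z).1 (lt_of_le_of_ne h1 hne), h⟩
    refine ⟨?_, h1, h3⟩
    by_cases h : gauge K z = 1
    · rw [h]; exact (hs1 n).le
    · exact (h3 h).trans (hc z)
  have hmax : ∀ n, s n ≤ max |c (p n)| (max |c (q n)| |c (q n - p n)|) := fun n => by
    by_contra! h
    rw [max_lt_iff, max_lt_iff] at h
    have hp := not_not.1 (mt (hbd n _ (hpq n).left).2.2 (not_le.2 h.1))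
    have hq := not_not.1 (mt (hbd n _ (hpq n).right).2.2 (not_le.2 h.2.1))
    have hr := not_not.1 (mt (hbd n _ (hpq n).diff).2.2 (not_le.2 h.2.2))
    have := hK.criticalDet_le_wedge ⟨hp, hq, hr, (hpq n).pos⟩
    rw [(hpq n).wedge_eq] at this
    exact absurd (hlt n) (not_lt.2 this)
  obtain ⟨⟨P, Q⟩, -, φ, hφ, hlim⟩ :=
    (hK.isCompact_gauge_le_one.prod hK.isCompact_gauge_le_one).tendsto_subseq
      (x := fun n => (p n, q n))
      (fun n => ⟨(hbd n _ (hpq n).left).2.1, (hbd n _ (hpq n).right).2.1⟩)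
  have hsφ := hslim.comp hφ.tendsto_atTop
  have lim : ∀ {f : Plane × Plane → ℝ}, Continuous f →
      Tendsto (fun n => f (p (φ n), q (φ n))) atTop (𝓝 (f (P, Q))) :=
    fun hf => (hf.tendsto _).comp hlim
  have hgc := hK.continuous_gauge
  have lim1 : ∀ {f : Plane × Plane → Plane}, Continuous f →
      (∀ n, gauge (H n) (f (p n, q n)) = 1) → gauge K (f (P, Q)) = 1 := fun hf hn =>
    tendsto_nhds_unique (lim (f := fun x => gauge K (_ : Plane)) (hgc.comp hf))
      (tendsto_of_tendsto_of_tendsto_of_le_of_le hsφ tendsto_const_nhds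
        (fun n => (hbd (φ n) _ (hn _)).1) (fun n => (hbd (φ n) _ (hn _)).2.1))
  have hP : gauge K P = 1 := lim1 (f := fun x => x.1) (by fun_prop) fun n => (hpq n).left
  have hQ : gauge K Q = 1 := lim1 (f := fun x => x.2) (by fun_prop) fun n => (hpq n).right
  have hR : gauge K (Q - P) = 1 :=
    lim1 (f := fun x => x.2 - x.1) (by fun_prop) fun n => (hpq n).diff
  have hw0 : 0 ≤ wedge P Q := ge_of_tendsto' (lim continuous_wedge) fun n => (hpq _).pos.le
  have hw1 : wedge P Q ≤ criticalDet K := le_of_tendsto' (lim continuous_wedge) fun n => by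
    simp only [(hpq _).wedge_eq]; exact (hlt _).le
  have hhex : IsInscribedHexagon K P Q :=
    ⟨hP, hQ, hR, lt_of_le_of_ne hw0 (hK.wedge_ne_zero hP hQ hR).symm⟩
  have hcrit : IsCriticalHexagon K P Q := ⟨hhex, le_antisymm hw1 (hK.criticalDet_le_wedge hhex)⟩
  have hmaxlim : 1 ≤ max |c P| (max |c Q| |c (Q - P)|) :=
    le_of_tendsto_of_tendsto' hsφ
      (lim (f := fun x => max |c x.1| (max |c x.2| |c (x.2 - x.1)|)) (by fun_prop))
      fun n => hmax _
  have fin : ∀ {v w}, IsCriticalHexagon K v w → 1 ≤ |c v| →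
      ∃ p q, IsCriticalHexagon K p q ∧ c p = 1 := fun {v w} h hv => by
    have h1 : |c v| = 1 := le_antisymm (h.left ▸ hc v) hv
    rcases (abs_eq zero_le_one).1 h1 with h2 | h2
    · exact ⟨v, w, h, h2⟩
    · exact ⟨-v, -w, h.neg hK, by rw [map_neg, h2, neg_neg]⟩
  rcases le_max_iff.1 hmaxlim with h | h
  · exact fin hcrit h
  rcases le_max_iff.1 h with h | h
  · exact fin (hcrit.next hK) h
  · exact fin (hcrit.next_next hK) h

/-- A boundary arc of an irreducible domain that contains no vertex of a critical hexagon in its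
interior is a segment; only its midpoint is needed. -/
theorem IsIrreducibleDomain.gauge_add_eq_two {K : Set Plane} (hKi : IsIrreducibleDomain K)
    {v w : Plane} (hv : gauge K v = 1) (hw : gauge K w = 1) (hvw : 0 < wedge v w)
    (harc : ∀ p q, IsCriticalHexagon K p q → 0 < wedge v p → ¬ 0 < wedge p w) :
    gauge K (v + w) = 2 := by
  have hK := hKi.1
  have hle : gauge K (v + w) ≤ 2 := by
    have := hK.gauge_add v w; rw [hv, hw] at this; linarith
  by_contra hne
  have hlt : gauge K (v + w) < 2 := lt_of_le_of_ne hle hne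
  have hvw0 : v + w ≠ 0 := by
    intro h0
    have := (comb_eq_zero_iff hvw.ne' 1 1).1 (by rw [← h0]; module)
    exact one_ne_zero this.1
  have hpos := hK.gauge_pos hvw0
  -- the functional equal to one at both ends of the arc
  let g : Plane →ₗ[ℝ] ℝ :=
    { toFun := fun x => (wedge x w + wedge v x) / wedge v w
      map_add' := fun x y => by simp [wedge]; ring
      map_smul' := fun a x => by simp [wedge]; ring }
  have hg : ∀ x, g x = (wedge x w + wedge v x) / wedge v w := fun _ => rfl
  have hgc : Continuous g := g.continuous_of_finiteDimensional
  have hgcomb : ∀ a b : ℝ, g (a • v + b • w) = a + b := fun a b => by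
    rw [hg, wedge_comb_left, wedge_comb_right, wedge_self, wedge_self]
    field_simp; ring
  obtain ⟨x₀, hx₀, hmax⟩ := hK.isCompact_gauge_le_one.exists_isMaxOn ⟨v, hv.le⟩ hgc.continuousOn
  have hx₀ : gauge K x₀ ≤ 1 := hx₀
  set M := g x₀ with hM
  have hM1 : 1 < M := by
    have h1 : (gauge K (v + w))⁻¹ • (v + w) ∈ {x | gauge K x ≤ 1} :=
      (hK.gauge_normalize hvw0).le
    have h2 : g ((gauge K (v + w))⁻¹ • (v + w)) ≤ M := hmax h1
    have h3 : g (v + w) = 2 := by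
      have := hgcomb 1 1
      rw [one_smul, one_smul] at this
      rw [this]; norm_num
    rw [map_smul, h3, smul_eq_mul, ← div_eq_inv_mul] at h2
    refine lt_of_lt_of_le ?_ h2
    rwa [one_lt_div hpos]
  have hgle : ∀ x, g x ≤ M * gauge K x := fun x => by
    rcases eq_or_ne x 0 with rfl | hx
    · simp
    have h2 : g ((gauge K x)⁻¹ • x) ≤ M :=
      hmax (show _ ∈ {x | gauge K x ≤ 1} from (hK.gauge_normalize hx).le)
    rwa [map_smul, smul_eq_mul, ← div_eq_inv_mul, div_le_iff₀ (hK.gauge_pos hx)] at h2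
  have hMpos : 0 < M := by linarith
  have hc : ∀ x, |(M⁻¹ • g) x| ≤ gauge K x := fun x => by
    have h1 := hgle x
    have h2 := hgle (-x)
    rw [hK.gauge_neg, map_neg] at h2
    rw [LinearMap.smul_apply, smul_eq_mul, ← div_eq_inv_mul, abs_div, abs_of_pos hMpos,
      div_le_iff₀ hMpos, abs_le]
    constructor <;> linarith
  have hcx₀ : (M⁻¹ • g) x₀ = 1 := by
    rw [LinearMap.smul_apply, smul_eq_mul, ← hM, inv_mul_cancel₀ hMpos.ne']
  have hx₀1 : gauge K x₀ = 1 := le_antisymm hx₀ (by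
    have := hc x₀; rwa [hcx₀, abs_one] at this)
  obtain ⟨p, q, hpq, hcp⟩ := hKi.exists_criticalHexagon_on_face hc hx₀1 hcx₀
  have hgp : g p = M := by
    rw [LinearMap.smul_apply, smul_eq_mul, ← div_eq_inv_mul, div_eq_one_iff_eq hMpos.ne'] at hcp
    exact hcp
  have hp1 := hpq.left
  obtain ⟨a, b, rfl⟩ := exists_comb_of_wedge_ne_zero p hvw.ne'
  rw [hgcomb] at hgp
  have ha : 0 < a := by
    by_contra! ha
    have := hK.gauge_comb 1 (-a) (a • v + b • w) v
    rw [show (1 : ℝ) • (a • v + b • w) + (-a) • v = b • w by module, hK.gauge_smul, hw, hv, hp1,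
      abs_one, abs_of_pos (by linarith : 0 < b), abs_of_nonneg (by linarith : 0 ≤ -a)] at this
    linarith
  have hb : 0 < b := by
    by_contra! hb
    have := hK.gauge_comb 1 (-b) (a • v + b • w) w
    rw [show (1 : ℝ) • (a • v + b • w) + (-b) • w = a • v by module, hK.gauge_smul, hw, hv, hp1,
      abs_one, abs_of_pos (by linarith : 0 < a), abs_of_nonneg (by linarith : 0 ≤ -b)] at this
    linarith
  refine harc _ _ hpq ?_ ?_
  · rw [wedge_comb_right, wedge_self, mul_zero, zero_add]; exact mul_pos hb hvw
  · rw [wedge_comb_left, wedge_self, mul_zero, add_zero]; exact mul_pos ha hvw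

/-- In a cone with boundary vertices `p`, `q`, only `p` itself lies on the ray through `p`. -/
theorem IsInscribedHexagon.eq_left_of_wedge {K : Set Plane} (hK : IsSymmConvexDomain K)
    {p q v : Plane} (h : IsInscribedHexagon K p q) (hv : gauge K v = 1) (hc : InCone p q v)
    (h0 : wedge p v = 0) : v = p := by
  obtain ⟨x, y, rfl, hx, -⟩ := h.exists_coords hK hv hc
  rw [wedge_comb_right, wedge_self, mul_zero, zero_add] at h0
  obtain rfl := (mul_eq_zero.1 h0).resolve_right h.pos.ne'
  rw [zero_smul, add_zero, hK.gauge_smul, h.left, mul_one, abs_of_nonneg hx] at hv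
  simp [hv]

theorem IsInscribedHexagon.eq_right_of_wedge {K : Set Plane} (hK : IsSymmConvexDomain K)
    {p q v : Plane} (h : IsInscribedHexagon K p q) (hv : gauge K v = 1) (hc : InCone p q v)
    (h0 : wedge v q = 0) : v = q := by
  obtain ⟨x, y, rfl, -, hy, -⟩ := h.exists_coords hK hv hc
  rw [wedge_comb_left, wedge_self, mul_zero, add_zero] at h0
  obtain rfl := (mul_eq_zero.1 h0).resolve_right h.pos.ne'
  rw [zero_smul, zero_add, hK.gauge_smul, h.right, mul_one, abs_of_nonneg hy] at hv
  simp [hv]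

namespace IsCriticalHexagon

variable {K : Set Plane} (hK : IsSymmConvexDomain K) (hKp : ¬ IsParallelogram K)

include hK hKp

/-- Strict form of `IsCriticalHexagon.inCone_next`. -/
theorem wedge_next_pos {p q p' q' : Plane} (h : IsCriticalHexagon K p q)
    (h' : IsCriticalHexagon K p' q') (hc : InCone p q p') (hpos : 0 < wedge p p') :
    0 < wedge q q' := by
  have hc' := inCone_next hK hKp h h' hc
  refine lt_of_le_of_ne hc'.1 fun h0 => ?_
  have := (h.next hK).eq_left_of_wedge hK h'.right hc' h0.symm
  subst this
  rw [h.left_unique hK hKp h', wedge_self] at hpos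
  exact lt_irrefl _ hpos

/-- A critical vertex between `q` and `q'` is preceded by one between `p` and `p'`. -/
theorem exists_vertex_between {p q p' q' v w : Plane} (h : IsCriticalHexagon K p q)
    (h' : IsCriticalHexagon K p' q') (hc : InCone p q p') (hpos : 0 < wedge p p')
    (hv : IsCriticalHexagon K v w) (h1 : 0 < wedge q v) (h2 : 0 < wedge v q') :
    ∃ u, IsCriticalHexagon K u v ∧ 0 < wedge p u ∧ 0 < wedge u p' := by
  have hc' := inCone_next hK hKp h h' hc
  have hqq := wedge_next_pos hK hKp h h' hc hpos
  obtain ⟨a, b, hab⟩ := exists_comb_of_wedge_ne_zero v hqq.ne'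
  have ha : 0 < a := by
    rw [hab, wedge_comb_left, wedge_self, mul_zero, add_zero] at h2
    exact (mul_pos_iff_of_pos_right hqq).1 h2
  have hb : 0 < b := by
    rw [hab, wedge_comb_right, wedge_self, mul_zero, zero_add] at h1
    exact (mul_pos_iff_of_pos_right hqq).1 h1
  have hv1 : InCone q (q - p) v := by
    refine ⟨h1.le, ?_⟩
    rw [hab, wedge_comb_left]
    have := (h.next hK).pos
    have := hc'.2
    positivity
  have hv2 : InCone p' q' v := by
    refine ⟨?_, h2.le⟩
    rw [hab, wedge_comb_right]
    have := hc.2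
    have := h'.pos
    positivity
  have hu1 := inCone_prev hK hKp (h.next hK) hv hv1
  rw [sub_sub_cancel] at hu1
  have hu2 := inCone_prev hK hKp h' hv hv2
  have hu := hv.prev hK
  refine ⟨v - w, hu, lt_of_le_of_ne hu1.1 fun h0 => ?_, lt_of_le_of_ne hu2.2 fun h0 => ?_⟩
  · have e := h.eq_left_of_wedge hK hu.left hu1 h0.symm
    rw [e] at hu
    rw [h.right_unique hK hKp hu, wedge_self] at h1
    exact lt_irrefl _ h1
  · have e := (h'.prev hK).eq_right_of_wedge hK hu.left hu2 h0.symm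
    rw [e] at hu
    rw [h'.right_unique hK hKp hu, wedge_self] at h2
    exact lt_irrefl _ h2

end IsCriticalHexagon

/-- For an irreducible domain there is always a further critical vertex between two critical
vertices: otherwise the arcs between the corresponding vertices of the two hexagons are three
segments, and the midpoints of these form an inscribed hexagon of determinant at most `Δ(K)`. -/
theorem IsIrreducibleDomain.exists_vertex_between {K : Set Plane} (hKi : IsIrreducibleDomain K)
    (hKp : ¬ IsParallelogram K) {p q p' q' : Plane} (h : IsCriticalHexagon K p q)
    (h' : IsCriticalHexagon K p' q') (hpos : 0 < wedge p p') :
    ∃ v w, IsCriticalHexagon K v w ∧ 0 < wedge p v ∧ 0 < wedge v p' := by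
  have hK := hKi.1
  by_contra! hgap
  replace hgap : ∀ v w, IsCriticalHexagon K v w → 0 < wedge p v → ¬ 0 < wedge v p' :=
    fun v w h1 h2 => not_lt.2 (hgap v w h1 h2)
  have hc : InCone p q p' := by
    refine ⟨hpos.le, ?_⟩
    have := not_lt.1 (hgap _ _ (h.next hK) h.pos)
    rw [wedge_swap p' q] at this
    linarith
  have hpos2 := IsCriticalHexagon.wedge_next_pos hK hKp h h' hc hpos
  have hc2 := IsCriticalHexagon.inCone_next hK hKp h h' hc
  have hpos3 := IsCriticalHexagon.wedge_next_pos hK hKp (h.next hK) (h'.next hK) hc2 hpos2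
  have hgap2 : ∀ v w, IsCriticalHexagon K v w → 0 < wedge q v → ¬ 0 < wedge v q' :=
    fun v w hv h1 h2 => by
      obtain ⟨u, hu, hu1, hu2⟩ :=
        IsCriticalHexagon.exists_vertex_between hK hKp h h' hc hpos hv h1 h2
      exact hgap _ _ hu hu1 hu2
  have hgap3 : ∀ v w, IsCriticalHexagon K v w → 0 < wedge (q - p) v → ¬ 0 < wedge v (q' - p') :=
    fun v w hv h1 h2 => by
      obtain ⟨u, hu, hu1, hu2⟩ := IsCriticalHexagon.exists_vertex_between hK hKp (h.next hK)
        (h'.next hK) hc2 hpos2 hv h1 h2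
      exact hgap2 _ _ hu hu1 hu2
  have e1 := hKi.gauge_add_eq_two h.left h'.left hpos hgap
  have e2 := hKi.gauge_add_eq_two h.right h'.right hpos2 hgap2
  have e3 := hKi.gauge_add_eq_two h.diff h'.diff hpos3 hgap3
  set P := (1 / 2 : ℝ) • (p + p')
  set Q := (1 / 2 : ℝ) • (q + q')
  have half : ∀ z : Plane, gauge K z = 2 → gauge K ((1 / 2 : ℝ) • z) = 1 := fun z hz => by
    rw [hK.gauge_smul, hz, abs_of_pos (by norm_num)]; norm_num
  have hle : wedge P Q ≤ criticalDet K ∧ 0 < wedge P Q := by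
    have hΔ := hK.criticalDet_pos
    obtain ⟨x, y, hxy, hx0, hy0, hx1, hy1, hxy1⟩ := h.exists_coords hK h'.left hc
    obtain ⟨a, b, hab, ha0, hb0, ha1, hb1, hab1⟩ := (h.next hK).exists_coords hK h'.right hc2
    have hw : wedge p q = criticalDet K := h.wedge_eq
    have hq' : q' = (-b) • p + (a + b) • q := by rw [hab]; module
    have hdet : x * (a + b) + y * b = 1 := by
      have := h'.wedge_eq
      rw [hxy, hq', wedge_comb, hw] at this
      have := mul_right_cancel₀ hΔ.ne' (this.trans (one_mul _).symm)
      linarith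
    have hsum : x + a + b ≤ 2 := by
      nlinarith [mul_nonneg (sub_nonneg.2 hxy1) hb0,
        mul_nonneg (sub_nonneg.2 hx1) (sub_nonneg.2 ha1)]
    have e : wedge P Q = (2 + (x + a + b)) / 4 * criticalDet K := by
      have e1 : P = ((1 + x) / 2) • p + (y / 2) • q := by simp only [P]; rw [hxy]; module
      have e2 : Q = (-b / 2) • p + ((1 + a + b) / 2) • q := by simp only [Q]; rw [hq']; module
      rw [e1, e2, wedge_comb, hw]
      congr 1
      linarith
    rw [e]
    constructor
    · nlinarith
    · positivity
  have hhex : IsInscribedHexagon K P Q :=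
    ⟨half _ e1, half _ e2, by
      rw [show Q - P = (1 / 2 : ℝ) • ((q - p) + (q' - p')) by simp only [P, Q]; module]
      exact half _ e3, hle.2⟩
  refine hgap P Q ⟨hhex, le_antisymm hle.1 (hK.criticalDet_le_wedge hhex)⟩ ?_ ?_
  · rw [show P = (1 / 2 : ℝ) • p + (1 / 2 : ℝ) • p' by simp only [P]; module, wedge_comb_right,
      wedge_self]
    linarith
  · rw [show P = (1 / 2 : ℝ) • p + (1 / 2 : ℝ) • p' by simp only [P]; module, wedge_comb_left,
      wedge_self]
    linarith

/-! ### The topology of the space of lattices -/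

theorem mem_GLInt_iff (g : GL (Fin 2) ℝ) : g ∈ GLInt ↔
    (∀ i j, g.1 i j ∈ Set.range ((↑) : ℤ → ℝ)) ∧
      ∀ i j, (g⁻¹).1 i j ∈ Set.range ((↑) : ℤ → ℝ) := by
  constructor
  · rintro ⟨γ, rfl⟩
    rw [← map_inv]
    exact ⟨fun i j => ⟨γ.1 i j, rfl⟩, fun i j => ⟨(γ⁻¹).1 i j, rfl⟩⟩
  · rintro ⟨h1, h2⟩
    choose A hA using h1
    choose B hB using h2
    have hinj : Function.Injective ((Int.castRingHom ℝ).mapMatrix (m := Fin 2)) :=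
      Matrix.map_injective Int.cast_injective
    have eA : (Int.castRingHom ℝ).mapMatrix (Matrix.of A) = g.1 := by
      ext i j; exact hA i j
    have eB : (Int.castRingHom ℝ).mapMatrix (Matrix.of B) = (g⁻¹).1 := by
      ext i j; exact hB i j
    refine ⟨⟨Matrix.of A, Matrix.of B, hinj ?_, hinj ?_⟩, Units.ext eA⟩
    · rw [map_mul, eA, eB, map_one]; exact g.mul_inv
    · rw [map_mul, eA, eB, map_one]; exact g.inv_mul

instance isClosed_GLInt : IsClosed (GLInt : Set (GL (Fin 2) ℝ)) := by
  have hZ : IsClosed (Set.range ((↑) : ℤ → ℝ)) := Int.isClosedEmbedding_coe_real.isClosed_range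
  have e : (GLInt : Set (GL (Fin 2) ℝ)) =
      (⋂ i, ⋂ j, {g | g.1 i j ∈ Set.range ((↑) : ℤ → ℝ)}) ∩
        ⋂ i, ⋂ j, {g | (g⁻¹).1 i j ∈ Set.range ((↑) : ℤ → ℝ)} := by
    ext g
    simp only [SetLike.mem_coe, mem_GLInt_iff, Set.mem_inter_iff, Set.mem_iInter,
      Set.mem_ofPred_eq]
  rw [e]
  refine IsClosed.inter ?_ ?_ <;>
    refine isClosed_iInter fun i => isClosed_iInter fun j => hZ.preimage ?_
  · exact Units.continuous_val.matrix_elem i j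
  · exact (Units.continuous_val.comp continuous_inv).matrix_elem i j

theorem isAdmissible_mk {K : Set Plane} (h0 : (0 : Plane) ∈ K) (g : GL (Fin 2) ℝ) :
    IsAdmissible K (g : LatticeSpace) ↔
      ∀ z : Fin 2 → ℤ, z ≠ 0 → g.1.mulVec (fun i => (z i : ℝ)) ∉ K := by
  change latticeOf g ∩ K = {0} ↔ _
  have hinj : Function.Injective g.1.mulVec := Matrix.mulVec_injective_of_isUnit g.isUnit
  constructor
  · intro h z hz hzK
    have h1 : g.1.mulVec (fun i => (z i : ℝ)) ∈ latticeOf g ∩ K := ⟨⟨z, rfl⟩, hzK⟩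
    rw [h, Set.mem_singleton_iff, ← g.1.mulVec_zero] at h1
    exact hz (funext fun i => Int.cast_eq_zero.1 (congrFun (hinj h1) i))
  · intro h
    ext x
    constructor
    · rintro ⟨⟨z, rfl⟩, hzK⟩
      by_contra hne
      refine h z (fun hz => hne ?_) hzK
      subst hz
      have : (fun i => (((0 : Fin 2 → ℤ) i : ℤ) : ℝ)) = 0 := by ext; simp
      rw [this, Matrix.mulVec_zero]; rfl
    · rintro rfl
      refine ⟨⟨0, ?_⟩, h0⟩
      have : (fun i => (((0 : Fin 2 → ℤ) i : ℤ) : ℝ)) = 0 := by ext; simp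
      rw [this, Matrix.mulVec_zero]

/-- The critical locus is closed: admissibility for an open set and the covolume condition are both
closed conditions on a matrix representing the lattice. -/
theorem IsSymmConvexDomain.isClosed_criticalLocus {K : Set Plane} (hK : IsSymmConvexDomain K) :
    IsClosed (criticalLocus K) := by
  have hq : Topology.IsQuotientMap (QuotientGroup.mk : GL (Fin 2) ℝ → LatticeSpace) :=
    QuotientGroup.isOpenQuotientMap_mk.isQuotientMap
  rw [← hq.isClosed_preimage]
  have e : (QuotientGroup.mk : GL (Fin 2) ℝ → LatticeSpace) ⁻¹' criticalLocus K =
      (⋂ z : Fin 2 → ℤ, ⋂ _ : z ≠ 0, {g : GL (Fin 2) ℝ | g.1.mulVec (fun i => (z i : ℝ)) ∈ Kᶜ}) ∩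
        {g : GL (Fin 2) ℝ | |g.1.det| = criticalDet K} := by
    ext g
    simp only [Set.mem_preimage, criticalLocus, Set.mem_ofPred_eq, isAdmissible_mk hK.zero_mem,
      Set.mem_inter_iff, Set.mem_iInter, Set.mem_compl_iff]
    exact Iff.rfl
  rw [e]
  refine IsClosed.inter (isClosed_iInter fun z => isClosed_iInter fun _ => ?_) ?_
  · exact hK.isOpen.isClosed_compl.preimage
      (Units.continuous_val.matrix_mulVec continuous_const)
  · exact isClosed_eq Units.continuous_val.matrix_det.abs continuous_const

open Classical in
/-- The lattice with basis `x.1`, `x.2`, with the junk value `ℤ²` if these are dependent. -/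
noncomputable def latticeOfPair (x : Plane × Plane) : LatticeSpace :=
  if h : wedge x.1 x.2 ≠ 0 then latticeMk x.1 x.2 h else ((1 : GL (Fin 2) ℝ) : LatticeSpace)

theorem latticeOfPair_eq {p q : Plane} (h : wedge p q ≠ 0) :
    latticeOfPair (p, q) = latticeMk p q h := dif_pos h

theorem continuousOn_latticeOfPair :
    ContinuousOn latticeOfPair {x | wedge x.1 x.2 ≠ 0} := by
  rw [continuousOn_iff_continuous_domRestrict]
  have e : Set.domRestrict {x : Plane × Plane | wedge x.1 x.2 ≠ 0} latticeOfPair =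
      fun x => latticeMk x.1.1 x.1.2 x.2 := by
    ext x; exact latticeOfPair_eq x.2
  rw [e]
  refine continuous_quot_mk.comp (Units.continuous_iff.2 ⟨?_, ?_⟩)
  · refine continuous_matrix fun i j => ?_
    simp only [Function.comp_def, columnsGL_val]
    fin_cases i <;> fin_cases j <;> simp <;> fun_prop
  · have e' : (Units.val ∘ fun x : {x : Plane × Plane | wedge x.1 x.2 ≠ 0} =>
        (columnsGL x.1.1 x.1.2 x.2)⁻¹) =
        fun x => (wedge x.1.1 x.1.2)⁻¹ • !![x.1.2 1, -x.1.2 0; -x.1.1 1, x.1.1 0] := by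
      ext x : 1
      rw [Function.comp_apply, Matrix.coe_units_inv, Matrix.inv_def, columnsGL_val, det_columns,
        Matrix.adjugate_fin_two_of, Ring.inverse_eq_inv']
    have e'' : (fun x : {x : Plane × Plane | wedge x.1 x.2 ≠ 0} =>
        ((columnsGL x.1.1 x.1.2 x.2)⁻¹ : GL (Fin 2) ℝ).1) =
        fun x => (wedge x.1.1 x.1.2)⁻¹ • !![x.1.2 1, -x.1.2 0; -x.1.1 1, x.1.1 0] := e'
    rw [e'']
    refine ((continuous_wedge.comp continuous_subtype_val).inv₀ fun x => x.2).smul ?_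
    refine continuous_matrix fun i j => ?_
    fin_cases i <;> fin_cases j <;> simp <;> fun_prop

/-- Closed graph criterion: a function whose graph over `S` is cut out by a compact set is
continuous on `S`. -/
theorem continuousOn_of_isCompact_graph {X Y : Type*} [TopologicalSpace X] [T2Space X]
    [TopologicalSpace Y] {f : X → Y} {S : Set X} {G : Set (X × Y)} (hG : IsCompact G)
    (h1 : ∀ x ∈ S, (x, f x) ∈ G) (h2 : ∀ x ∈ S, ∀ y, (x, y) ∈ G → y = f x) :
    ContinuousOn f S := by
  rw [continuousOn_iff_isClosed]
  intro t ht
  refine ⟨Prod.fst '' (G ∩ Prod.snd ⁻¹' t),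
    ((hG.inter_right (ht.preimage continuous_snd)).image continuous_fst).isClosed, ?_⟩
  ext x
  constructor
  · rintro ⟨hx, hxS⟩
    exact ⟨⟨(x, f x), ⟨h1 x hxS, hx⟩, rfl⟩, hxS⟩
  · rintro ⟨⟨⟨x', y⟩, ⟨hG', hy⟩, rfl⟩, hxS⟩
    refine ⟨?_, hxS⟩
    have := h2 _ hxS y hG'
    rw [Set.mem_preimage, ← this]; exact hy

/-! ### The critical locus of an irreducible domain is a circle -/

/-- The radial projection to the boundary of `K` of the point dividing the segment from `p` to `q`
in the ratio `t : 1 - t`. -/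
noncomputable def arcPoint (K : Set Plane) (p q : Plane) (t : ℝ) : Plane :=
  (gauge K ((1 - t) • p + t • q))⁻¹ • ((1 - t) • p + t • q)

section Arc

variable {K : Set Plane} (hK : IsSymmConvexDomain K) {p q : Plane} (hpq : IsInscribedHexagon K p q)

include hK hpq

theorem gauge_pos_arc (t : ℝ) : 0 < gauge K ((1 - t) • p + t • q) := by
  refine hK.gauge_pos fun h => ?_
  obtain ⟨h1, h2⟩ := (comb_eq_zero_iff hpq.pos.ne' _ _).1 h
  linarith

theorem continuous_arcPoint : Continuous (arcPoint K p q) := by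
  have h : Continuous fun t : ℝ => (1 - t) • p + t • q := by fun_prop
  exact ((hK.continuous_gauge.comp h).inv₀ fun t => (gauge_pos_arc hK hpq t).ne').smul h

omit hK in
theorem arcPoint_zero : arcPoint K p q 0 = p := by simp [arcPoint, hpq.left]

omit hK in
theorem arcPoint_one : arcPoint K p q 1 = q := by simp [arcPoint, hpq.right]

theorem inCone_arcPoint {t : ℝ} (ht : t ∈ Set.Icc (0 : ℝ) 1) : InCone p q (arcPoint K p q t) := by
  rw [arcPoint, smul_add, smul_smul, smul_smul, inCone_comb_iff hpq.pos]
  have := gauge_pos_arc hK hpq t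
  have := sub_nonneg.2 ht.2
  have := ht.1
  constructor <;> positivity

theorem wedge_arcPoint_pos_iff (s t : ℝ) :
    0 < wedge (arcPoint K p q s) (arcPoint K p q t) ↔ s < t := by
  have h1 := inv_pos.2 (gauge_pos_arc hK hpq s)
  have h2 := inv_pos.2 (gauge_pos_arc hK hpq t)
  rw [arcPoint, arcPoint, wedge_smul_left, wedge_smul_right, wedge_comb,
    mul_pos_iff_of_pos_left h1, mul_pos_iff_of_pos_left h2, mul_pos_iff_of_pos_right hpq.pos]
  constructor <;> intro h <;> linarith

theorem arcPoint_injective : Function.Injective (arcPoint K p q) := by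
  intro s t h
  by_contra hne
  rcases lt_or_gt_of_ne hne with hlt | hlt
  · have := (wedge_arcPoint_pos_iff hK hpq s t).2 hlt
    rw [h, wedge_self] at this; exact lt_irrefl _ this
  · have := (wedge_arcPoint_pos_iff hK hpq t s).2 hlt
    rw [h, wedge_self] at this; exact lt_irrefl _ this

theorem exists_arcPoint_eq {v : Plane} (hv : gauge K v = 1) (hc : InCone p q v) :
    ∃ t ∈ Set.Icc (0 : ℝ) 1, arcPoint K p q t = v := by
  obtain ⟨x, y, rfl, hx, hy, -, -, hxy⟩ := hpq.exists_coords hK hv hc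
  have hs : 0 < x + y := by linarith
  refine ⟨y / (x + y), ⟨by positivity, (div_le_one hs).2 (by linarith)⟩, ?_⟩
  have e : (1 - y / (x + y)) • p + (y / (x + y)) • q = (x + y)⁻¹ • (x • p + y • q) := by
    rw [show 1 - y / (x + y) = (x + y)⁻¹ * x by field_simp; ring, div_eq_inv_mul]; module
  rw [arcPoint, e, hK.gauge_smul, hv, mul_one, abs_of_pos (inv_pos.2 hs), inv_inv, smul_smul,
    mul_inv_cancel₀ hs.ne', one_smul]

end Arc

theorem IsSymmConvexDomain.isCompact_criticalHexagons {K : Set Plane} (hK : IsSymmConvexDomain K) :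
    IsCompact {x : Plane × Plane | IsCriticalHexagon K x.1 x.2} := by
  have e : {x : Plane × Plane | IsCriticalHexagon K x.1 x.2} =
      {x : Plane × Plane | gauge K x.1 = 1 ∧ gauge K x.2 = 1 ∧ gauge K (x.2 - x.1) = 1} ∩
        {x | wedge x.1 x.2 = criticalDet K} := by
    ext x
    constructor
    · intro h; exact ⟨⟨h.left, h.right, h.diff⟩, h.wedge_eq⟩
    · rintro ⟨⟨h1, h2, h3⟩, h4⟩
      have h4 : wedge x.1 x.2 = criticalDet K := h4
      exact ⟨⟨h1, h2, h3, by rw [h4]; exact hK.criticalDet_pos⟩, h4⟩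
  rw [e]
  exact hK.isCompact_hexagons.inter_right (isClosed_eq continuous_wedge continuous_const)

/-- The vertices of the critical hexagons of an irreducible domain fill the arc between two
consecutive vertices of one of them. They form a closed set, in which gaps are excluded by
`IsIrreducibleDomain.exists_vertex_between`. -/
theorem IsIrreducibleDomain.exists_criticalHexagon_arcPoint {K : Set Plane}
    (hKi : IsIrreducibleDomain K) (hKp : ¬ IsParallelogram K) {p q : Plane}
    (hpq : IsCriticalHexagon K p q) {t : ℝ} (ht : t ∈ Set.Icc (0 : ℝ) 1) :
    ∃ w, IsCriticalHexagon K (arcPoint K p q t) w := by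
  have hK := hKi.1
  have hh := hpq.toIsInscribedHexagon
  set C : Set ℝ := {s | ∃ w, IsCriticalHexagon K (arcPoint K p q s) w} with hC
  have hCc : IsClosed C := by
    have e : C = arcPoint K p q ⁻¹'
        (Prod.fst '' {x : Plane × Plane | IsCriticalHexagon K x.1 x.2}) := by
      ext s
      constructor
      · rintro ⟨w, hw⟩; exact ⟨(_, w), hw, rfl⟩
      · rintro ⟨⟨v, w⟩, hw, hv⟩
        have hw : IsCriticalHexagon K v w := hw
        have hv : v = _ := hv
        exact ⟨w, hv ▸ hw⟩
    rw [e]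
    exact ((hK.isCompact_criticalHexagons.image continuous_fst).isClosed).preimage
      (continuous_arcPoint hK hh)
  have h0 : (0 : ℝ) ∈ C := ⟨q, by rw [arcPoint_zero hh]; exact hpq⟩
  have h1 : (1 : ℝ) ∈ C := ⟨q - p, by rw [arcPoint_one hh]; exact hpq.next hK⟩
  by_contra htC
  obtain ⟨a, ⟨haC, ha⟩, hamax⟩ := ((isCompact_Icc (a := 0) (b := t)).inter_left
    hCc).exists_isGreatest ⟨0, h0, ⟨le_rfl, ht.1⟩⟩
  obtain ⟨b, ⟨hbC, hb⟩, hbmin⟩ := ((isCompact_Icc (a := t) (b := 1)).inter_left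
    hCc).exists_isLeast ⟨1, h1, ⟨ht.2, le_rfl⟩⟩
  have hat : a < t := lt_of_le_of_ne ha.2 (by rintro rfl; exact htC haC)
  have htb : t < b := lt_of_le_of_ne hb.1 (by rintro rfl; exact htC hbC)
  obtain ⟨w, hw⟩ := haC
  obtain ⟨w', hw'⟩ := hbC
  have hab := (wedge_arcPoint_pos_iff hK hh a b).2 (hat.trans htb)
  obtain ⟨v, z, hv, hv1, hv2⟩ := hKi.exists_vertex_between hKp hw hw' hab
  have hca := inCone_arcPoint hK hh (t := a) ⟨ha.1, ha.2.trans ht.2⟩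
  have hcb := inCone_arcPoint hK hh (t := b) ⟨ht.1.trans hb.1, hb.2⟩
  have hvc : InCone p q v := by
    obtain ⟨x, y, hxy⟩ := exists_comb_of_wedge_ne_zero v hab.ne'
    have hx : 0 < x := by
      rw [hxy, wedge_comb_left, wedge_self, mul_zero, add_zero] at hv2
      exact (mul_pos_iff_of_pos_right hab).1 hv2
    have hy : 0 < y := by
      rw [hxy, wedge_comb_right, wedge_self, mul_zero, zero_add] at hv1
      exact (mul_pos_iff_of_pos_right hab).1 hv1
    rw [InCone, hxy, wedge_comb_left, wedge_comb_right]
    obtain ⟨_, _⟩ := hca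
    obtain ⟨_, _⟩ := hcb
    constructor <;> positivity
  obtain ⟨s, hs, rfl⟩ := exists_arcPoint_eq hK hh hv.left hvc
  rw [wedge_arcPoint_pos_iff hK hh] at hv1 hv2
  rcases le_total s t with h | h
  · exact absurd (hamax ⟨⟨z, hv⟩, ⟨hs.1, h⟩⟩) (not_le.2 hv1)
  · exact absurd (hbmin ⟨⟨z, hv⟩, ⟨h, hs.2⟩⟩) (not_le.2 hv2)

open Classical in
/-- The vertex that follows `p` in the critical hexagon through `p`, with junk value `0` if there is
no such hexagon. -/
noncomputable def nextVertex (K : Set Plane) (p : Plane) : Plane :=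
  if h : ∃ q, IsCriticalHexagon K p q then h.choose else 0

theorem nextVertex_spec {K : Set Plane} {p : Plane} (h : ∃ q, IsCriticalHexagon K p q) :
    IsCriticalHexagon K p (nextVertex K p) := by
  rw [nextVertex, dif_pos h]; exact h.choose_spec

theorem IsCriticalHexagon.nextVertex_eq {K : Set Plane} (hK : IsSymmConvexDomain K)
    (hKp : ¬ IsParallelogram K) {p q : Plane} (h : IsCriticalHexagon K p q) :
    nextVertex K p = q := h.right_unique hK hKp (nextVertex_spec ⟨q, h⟩)

theorem continuousOn_nextVertex {K : Set Plane} (hK : IsSymmConvexDomain K)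
    (hKp : ¬ IsParallelogram K) :
    ContinuousOn (nextVertex K) {p | ∃ q, IsCriticalHexagon K p q} :=
  continuousOn_of_isCompact_graph hK.isCompact_criticalHexagons (fun _ h => nextVertex_spec h)
    fun _ _ _ h => (IsCriticalHexagon.nextVertex_eq hK hKp h).symm

/-- The critical locus of an irreducible domain other than a parallelogram is a circle: the boundary
arc between consecutive vertices `p`, `q` of a critical hexagon, with its end points identified,
parametrizes it by sending a point to the unique critical lattice containing it. -/
theorem IsIrreducibleDomain.isEmbeddedCircle_criticalLocus {K : Set Plane}
    (hKi : IsIrreducibleDomain K) (hKp : ¬ IsParallelogram K) :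
    IsEmbeddedCircle (criticalLocus K) := by
  have hK := hKi.1
  obtain ⟨p, q, hpq⟩ := hK.exists_criticalHexagon
  have hh := hpq.toIsInscribedHexagon
  set γ := arcPoint K p q with hγ
  have hcrit : ∀ t ∈ Set.Icc (0 : ℝ) 1, IsCriticalHexagon K (γ t) (nextVertex K (γ t)) :=
    fun t ht => nextVertex_spec (hKi.exists_criticalHexagon_arcPoint hKp hpq ht)
  set F : ℝ → LatticeSpace := fun t => latticeOfPair (γ t, nextVertex K (γ t)) with hF
  have hFeq : ∀ {t v w} (h : IsCriticalHexagon K v w), γ t = v →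
      F t = latticeMk v w h.pos.ne' := fun {t v w} h e => by
    simp only [hF]
    rw [e, h.nextVertex_eq hK hKp, latticeOfPair_eq]
  have hF01 : F 0 = F 1 := by
    rw [hFeq hpq (arcPoint_zero hh), hFeq (hpq.next hK) (arcPoint_one hh)]
    obtain ⟨_, h⟩ := latticeMk_eq_of_unimodular hpq.pos.ne' (a := 0) (b := 1) (c := -1) (d := 1)
      (p' := q) (q' := q - p) (by simp) (by simp) (by push_cast; module)
    exact h.symm
  have hFc : ContinuousOn F (Set.Icc 0 1) := by
    have h1 : ContinuousOn γ (Set.Icc 0 1) := (continuous_arcPoint hK hh).continuousOn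
    have h2 : ContinuousOn (fun t => nextVertex K (γ t)) (Set.Icc 0 1) :=
      (continuousOn_nextVertex hK hKp).comp h1 fun t ht => ⟨_, hcrit t ht⟩
    exact continuousOn_latticeOfPair.comp (h1.prodMk h2) fun t ht => (hcrit t ht).pos.ne'
  have hγq : ∀ t ∈ Set.Ico (0 : ℝ) 1, γ t ≠ q := fun t ht h =>
    ht.2.ne (arcPoint_injective hK hh (h.trans (arcPoint_one hh).symm))
  have hinj : Set.InjOn F (Set.Ico 0 1) := by
    intro s hs t ht hst
    have hs' := hcrit s (Set.Ico_subset_Icc_self hs)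
    have ht' := hcrit t (Set.Ico_subset_Icc_self ht)
    rw [hFeq hs' rfl, hFeq ht' rfl] at hst
    have hmem : γ t ∈ (latticeMk _ _ hs'.pos.ne').points := by
      rw [hst, mem_points_latticeMk]; exact ⟨1, 0, by simp⟩
    exact (arcPoint_injective hK hh (hpq.eq_of_mem_points_of_inCone hK hKp hs'
      (inCone_arcPoint hK hh (Set.Ico_subset_Icc_self hs)) (hγq s hs)
      (inCone_arcPoint hK hh (Set.Ico_subset_Icc_self ht)) (hγq t ht) ht'.left hmem)).symm
  have hmem : ∀ t ∈ Set.Icc (0 : ℝ) 1, F t ∈ criticalLocus K := fun t ht => by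
    rw [hFeq (hcrit t ht) rfl]; exact (hcrit t ht).mem_criticalLocus hK
  have hsurj : ∀ L ∈ criticalLocus K, ∃ t ∈ Set.Ico (0 : ℝ) 1, F t = L := by
    intro L hL
    obtain ⟨v, w, h, rfl⟩ := hK.exists_criticalHexagon_of_mem hKp hL
    obtain ⟨v', w', h', hc, e⟩ := hpq.exists_vertex_inCone hK hKp h
    obtain ⟨t, ht, rfl⟩ := exists_arcPoint_eq hK hh h'.left hc
    rw [← e, ← hFeq h' rfl]
    rcases eq_or_lt_of_le ht.2 with rfl | h1
    · exact ⟨0, ⟨le_rfl, one_pos⟩, hF01⟩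
    · exact ⟨t, ⟨ht.1, h1⟩, rfl⟩
  have : Fact ((0 : ℝ) < 1) := ⟨one_pos⟩
  set f : AddCircle (1 : ℝ) → LatticeSpace := AddCircle.liftIco 1 0 F with hf
  have hfc : Continuous f := AddCircle.liftIco_zero_continuous hF01 hFc
  have hfapp : ∀ t ∈ Set.Ico (0 : ℝ) 1, f (t : AddCircle (1 : ℝ)) = F t := fun t ht =>
    AddCircle.liftIco_zero_coe_apply ht
  have hfinj : Function.Injective f := by
    intro x y hxy
    obtain ⟨s, hs, rfl⟩ := AddCircle.eq_coe_Ico x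
    obtain ⟨t, ht, rfl⟩ := AddCircle.eq_coe_Ico y
    rw [hfapp s hs, hfapp t ht] at hxy
    rw [hinj hs ht hxy]
  have hemb : Topology.IsEmbedding f := (hfc.isClosedEmbedding hfinj).isEmbedding
  let e := (AddCircle.homeomorphCircle (T := 1) one_ne_zero).symm
  refine ⟨f ∘ e, hemb.comp e.isEmbedding, ?_⟩
  rw [e.surjective.range_comp]
  ext L
  constructor
  · rintro ⟨x, rfl⟩
    obtain ⟨t, ht, rfl⟩ := AddCircle.eq_coe_Ico x
    rw [hfapp t ht]; exact hmem t (Set.Ico_subset_Icc_self ht)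
  · intro hL
    obtain ⟨t, ht, rfl⟩ := hsurj L hL
    exact ⟨t, hfapp t ht⟩

/-! ### Existence of irreducible domains -/

theorem abs_wedge_le_norm (x y : Plane) : |wedge x y| ≤ 2 * (‖x‖ * ‖y‖) := by
  have h : ∀ (z : Plane) i, |z i| ≤ ‖z‖ := fun z i => norm_le_pi_norm z i
  calc |wedge x y| ≤ |x 0 * y 1| + |x 1 * y 0| := by unfold wedge; exact abs_sub _ _
    _ = |x 0| * |y 1| + |x 1| * |y 0| := by rw [abs_mul, abs_mul]
    _ ≤ ‖x‖ * ‖y‖ + ‖x‖ * ‖y‖ := by gcongr <;> apply h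
    _ = _ := by ring

/-- All domains contained in `K` with the critical determinant of `K` contain one common ball: each
contains the four points `± p, ± q` of a critical hexagon, which are bounded and span a
parallelogram of area bounded below. -/
theorem IsSymmConvexDomain.exists_ball_subset {K : Set Plane} (hK : IsSymmConvexDomain K) :
    ∃ ρ > 0, ∀ H, IsSymmConvexDomain H → H ⊆ K → criticalDet H = criticalDet K →
      Metric.ball 0 ρ ⊆ H := by
  obtain ⟨C, hC, hCx⟩ := hK.exists_gauge_le_norm
  have hΔ := hK.criticalDet_pos
  refine ⟨criticalDet K / (4 * C), by positivity, fun H hH hHK hdet x hx => ?_⟩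
  rw [mem_ball_zero_iff, lt_div_iff₀ (by positivity)] at hx
  obtain ⟨p, q, hpq⟩ := hH.exists_criticalHexagon
  have hnorm : ∀ z, gauge H z = 1 → ‖z‖ ≤ C := fun z hz => by
    have h1 := hH.gauge_anti hHK z
    rw [hz] at h1
    exact (hCx z).trans (mul_le_of_le_one_right hC.le h1)
  have hxe := eq_comb_of_wedge_ne_zero x hpq.pos.ne'
  rw [hpq.wedge_eq, hdet] at hxe
  rw [← hH.gauge_lt_one_iff, hxe]
  have h1 := hH.gauge_comb (wedge x q / criticalDet K) (wedge p x / criticalDet K) p q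
  rw [hpq.left, hpq.right, abs_div, abs_div, abs_of_pos hΔ, mul_one, mul_one, ← add_div] at h1
  refine h1.trans_lt ((div_lt_one hΔ).2 ?_)
  have h2 := abs_wedge_le_norm x q
  have h3 := abs_wedge_le_norm p x
  have h4 := mul_le_mul_of_nonneg_left (hnorm q hpq.right) (norm_nonneg x)
  have h5 := mul_le_mul_of_nonneg_left (hnorm p hpq.left) (norm_nonneg x)
  linarith [mul_comm ‖p‖ ‖x‖]

/-- The critical determinant passes to the limit along a decreasing chain of domains. -/
theorem exists_lower_bound_of_isChain {K : Set Plane} (hK : IsSymmConvexDomain K)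
    {c : Set (Set Plane)} (hcS : ∀ H ∈ c, IsSymmConvexDomain H ∧ H ⊆ K ∧
      criticalDet H = criticalDet K) (hc : IsChain (· ⊆ ·) c) (hne : c.Nonempty) :
    ∃ H, IsSymmConvexDomain H ∧ criticalDet H = criticalDet K ∧ ∀ H' ∈ c, H ⊆ H' := by
  obtain ⟨ρ, hρ, hball⟩ := hK.exists_ball_subset
  obtain ⟨H₀, hH₀⟩ := hne
  set J := ⋂₀ c with hJ
  have hJconv : Convex ℝ J := convex_sInter fun H hH => (hcS H hH).1.convex
  have hballJ : Metric.ball 0 ρ ⊆ J := Set.subset_sInter fun H hH =>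
    hball H (hcS H hH).1 (hcS H hH).2.1 (hcS H hH).2.2
  have hballI : Metric.ball 0 ρ ⊆ interior J := interior_maximal hballJ Metric.isOpen_ball
  have hIne : (interior J).Nonempty := ⟨0, hballI (Metric.mem_ball_self hρ)⟩
  have hIsub : ∀ H ∈ c, interior J ⊆ H := fun H hH =>
    interior_subset.trans (Set.sInter_subset_of_mem hH)
  have hI : IsSymmConvexDomain (interior J) := by
    refine ⟨isOpen_interior, hIne, hJconv.interior,
      (hcS H₀ hH₀).1.isBounded.subset (hIsub H₀ hH₀), fun x hx => ?_⟩
    have e : (Homeomorph.neg Plane) ⁻¹' J = J := by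
      ext z
      simp only [Homeomorph.coe_neg, Set.mem_preimage, hJ, Set.mem_sInter]
      constructor
      · intro h H hH
        have := (hcS H hH).1.symm _ (h H hH)
        rwa [neg_neg] at this
      · exact fun h H hH => (hcS H hH).1.symm _ (h H hH)
    have := (Homeomorph.neg Plane).preimage_interior J
    rw [e] at this
    rw [← this] at hx
    exact hx
  refine ⟨interior J, hI, le_antisymm ?_ ?_, hIsub⟩
  · rw [← (hcS H₀ hH₀).2.2]; exact hI.criticalDet_mono (hcS H₀ hH₀).1 (hIsub H₀ hH₀)
  by_contra! hlt
  set a := criticalDet (interior J)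
  set b := criticalDet K
  have ha : 0 < a := hI.criticalDet_pos
  -- enlarging a critical lattice of the interior slightly keeps its covolume below `Δ(K)`
  obtain ⟨s, hs1, hs2, hs⟩ : ∃ s : ℝ, 1 < s ∧ s < 2 ∧ s ^ 2 * a < (2 - s) ^ 2 * b := by
    set m := (b - a) / (2 * (3 * a + 2 * b)) with hm
    have hd : 0 < 3 * a + 2 * b := by linarith
    have hm0 : 0 < m := div_pos (by linarith) (by linarith)
    have hm1 : m < 1 := by rw [hm, div_lt_one (by linarith)]; linarith
    have hm2 : m * (3 * a + 2 * b) = (b - a) / 2 := by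
      rw [hm, div_mul_eq_mul_div, mul_div_mul_right _ _ hd.ne']
    refine ⟨1 + m, by linarith, by linarith, ?_⟩
    have h1 : (1 + m) ^ 2 * a ≤ (1 + 3 * m) * a := by
      apply mul_le_mul_of_nonneg_right _ ha.le; nlinarith
    have h2 : (1 - 2 * m) * b ≤ (2 - (1 + m)) ^ 2 * b := by
      apply mul_le_mul_of_nonneg_right _ (ha.trans hlt).le; nlinarith
    linarith
  obtain ⟨p, q, hpq⟩ := hI.exists_criticalHexagon
  have hgs : ∀ z, gauge (interior J) z = 1 → gauge (interior J) (s • z) = s := fun z hz => by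
    rw [hI.gauge_smul, hz, mul_one, abs_of_pos (by linarith)]
  have hout : ∀ z, gauge (interior J) z = 1 → ∃ H ∈ c, s • z ∉ H := fun z hz => by
    by_contra! h
    have h1 : s • z ∈ J := h
    have h2 : s • z ∈ closure (interior J) := by
      rw [hJconv.closure_interior_eq_closure_of_nonempty_interior hIne]
      exact subset_closure h1
    rw [← hI.gauge_le_one_iff, hgs z hz] at h2
    linarith
  obtain ⟨H₁, hH₁, h1⟩ := hout p hpq.left
  obtain ⟨H₂, hH₂, h2⟩ := hout q hpq.right
  obtain ⟨H₃, hH₃, h3⟩ := hout (q - p) hpq.diff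
  -- the smallest of the three domains avoids all three points
  obtain ⟨H, hH, hs₁, hs₂, hs₃⟩ : ∃ H ∈ c, H ⊆ H₁ ∧ H ⊆ H₂ ∧ H ⊆ H₃ := by
    have hmin : ∀ A ∈ c, ∀ B ∈ c, ∃ D ∈ c, D ⊆ A ∧ D ⊆ B := fun A hA B hB => by
      rcases hc.total hA hB with h | h
      · exact ⟨A, hA, subset_rfl, h⟩
      · exact ⟨B, hB, h, subset_rfl⟩
    obtain ⟨D, hD, hD1, hD2⟩ := hmin H₁ hH₁ H₂ hH₂
    obtain ⟨E, hE, hE1, hE2⟩ := hmin D hD H₃ hH₃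
    exact ⟨E, hE, hE1.trans hD1, hE1.trans hD2, hE2⟩
  have hHd := (hcS H hH).1
  have hup : ∀ z, gauge (interior J) z = 1 → gauge H (s • z) ≤ s := fun z hz =>
    (hI.gauge_anti (hIsub H hH) _).trans_eq (hgs z hz)
  have e3 : s • q - s • p = s • (q - p) := by module
  have hlow : ∀ a b : ℤ, ¬ (a = 0 ∧ b = 0) →
      2 - s ≤ gauge H ((a : ℝ) • s • p + (b : ℝ) • s • q) := fun a b hab =>
    hHd.le_gauge_int_comb ((hHd.one_le_gauge_iff _).2 fun h => h1 (hs₁ h))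
      ((hHd.one_le_gauge_iff _).2 fun h => h2 (hs₂ h))
      (by rw [e3]; exact (hHd.one_le_gauge_iff _).2 fun h => h3 (hs₃ h))
      (hup p hpq.left) (hup q hpq.right) (by rw [e3]; exact hup _ hpq.diff) hs2.le hab
  have h2s : 0 < 2 - s := by linarith
  set r := s / (2 - s) with hr
  have hr0 : 0 < r := by positivity
  have hw : wedge (r • p) (r • q) = r ^ 2 * a := by
    rw [wedge_smul_left, wedge_smul_right, hpq.wedge_eq]; ring
  have hw0 : 0 < wedge (r • p) (r • q) := by rw [hw]; positivity
  have hadm : IsAdmissible H (latticeMk (r • p) (r • q) hw0.ne') := by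
    rw [isAdmissible_latticeMk hHd]
    intro a b hab
    have e : (a : ℝ) • r • p + (b : ℝ) • r • q =
        (2 - s)⁻¹ • ((a : ℝ) • s • p + (b : ℝ) • s • q) := by
      rw [hr, div_eq_inv_mul]; module
    rw [e, hHd.gauge_smul, abs_of_pos (inv_pos.2 h2s), ← div_eq_inv_mul, le_div_iff₀ h2s, one_mul]
    exact hlow a b hab
  have hfin := criticalDet_le_covol hadm
  rw [covol_latticeMk, abs_of_pos hw0, hw, (hcS H hH).2.2, hr, div_pow, div_mul_eq_mul_div,
    le_div_iff₀ (by positivity)] at hfin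
  linarith

/-- Every domain contains an irreducible domain with the same critical determinant. -/
theorem IsSymmConvexDomain.exists_irreducible_subset {K : Set Plane} (hK : IsSymmConvexDomain K) :
    ∃ H, IsIrreducibleDomain H ∧ H ⊆ K ∧ criticalDet H = criticalDet K := by
  obtain ⟨M, -, hM⟩ := zorn_superset_nonempty
    {H | IsSymmConvexDomain H ∧ H ⊆ K ∧ criticalDet H = criticalDet K}
    (fun c hcS hc hne => by
      obtain ⟨H, hH, hdet, hsub⟩ := exists_lower_bound_of_isChain hK hcS hc hne
      obtain ⟨H₀, hH₀⟩ := hne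
      exact ⟨H, ⟨hH, (hsub H₀ hH₀).trans (hcS hH₀).2.1, hdet⟩, hsub⟩)
    K ⟨hK, subset_rfl, rfl⟩
  obtain ⟨⟨hMd, hMK, hMdet⟩, hmin⟩ := hM
  refine ⟨M, ⟨hMd, fun H hH hHM => ?_⟩, hMK, hMdet⟩
  refine lt_of_le_of_ne (hH.criticalDet_mono hMd hHM.1) fun heq => hHM.2 ?_
  exact hmin ⟨hH, hHM.1.trans hMK, heq.trans hMdet⟩ hHM.1

/-! ### Parallelograms -/

section Parallelogram

open MeasureTheory

/-- The basis of the plane consisting of two independent vectors. -/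
noncomputable def planeBasis (p q : Plane) (h : wedge p q ≠ 0) : Module.Basis (Fin 2) ℝ Plane :=
  basisOfLinearIndependentOfCardEqFinrank (b := ![p, q])
    (LinearIndependent.pair_iff.2 fun s t e => (comb_eq_zero_iff h s t).1 e) (by simp)

theorem coe_planeBasis (p q : Plane) (h : wedge p q ≠ 0) : ⇑(planeBasis p q h) = ![p, q] :=
  coe_basisOfLinearIndependentOfCardEqFinrank _ _

/-- Minkowski's theorem in the plane. -/
theorem IsSymmConvexDomain.volume_le {K : Set Plane} (hK : IsSymmConvexDomain K) {p q : Plane}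
    (h : wedge p q ≠ 0) (hadm : IsAdmissible K (latticeMk p q h)) :
    volume K ≤ ENNReal.ofReal |wedge p q| * 4 := by
  by_contra! hlt
  set b := planeBasis p q h with hb
  have hfund := ZSpan.isAddFundamentalDomain' b volume
  have hvol : volume (ZSpan.fundamentalDomain b) = ENNReal.ofReal |wedge p q| := by
    rw [ZSpan.volume_fundamentalDomain, hb, coe_planeBasis]
    congr 2
    rw [Matrix.det_fin_two, wedge]
    simp
  have : Countable (Submodule.span ℤ (Set.range b)).toAddSubgroup :=
    inferInstanceAs (Countable (Submodule.span ℤ (Set.range b)))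
  obtain ⟨⟨x, hx⟩, hx0, hxK⟩ := exists_ne_zero_mem_lattice_of_measure_mul_two_pow_lt_measure hfund
    hK.symm hK.convex (by
      rw [hvol]
      refine lt_of_eq_of_lt ?_ hlt
      congr 1
      rw [Module.finrank_fin_fun]; norm_num)
  have hx' : x ∈ Submodule.span ℤ (Set.range b) := hx
  rw [hb, coe_planeBasis, Matrix.range_cons_cons_empty, Submodule.mem_span_pair] at hx'
  obtain ⟨m, n, rfl⟩ := hx'
  have hmem : m • p + n • q ∈ (latticeMk p q h).points ∩ K :=
    ⟨(mem_points_latticeMk h _).2 ⟨m, n, by simp only [Int.cast_smul_eq_zsmul]⟩, hxK⟩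
  rw [hadm, Set.mem_singleton_iff] at hmem
  exact hx0 (Subtype.ext hmem)

/-- The open parallelogram with centre `0` and sides `2u`, `2v`. -/
def openParallelogram (u v : Plane) : Set Plane :=
  {p | ∃ a b : ℝ, a ∈ Set.Ioo (-1 : ℝ) 1 ∧ b ∈ Set.Ioo (-1 : ℝ) 1 ∧ p = a • u + b • v}

theorem mem_openParallelogram_iff {u v : Plane} (h : wedge u v ≠ 0) (a b : ℝ) :
    a • u + b • v ∈ openParallelogram u v ↔ a ∈ Set.Ioo (-1 : ℝ) 1 ∧ b ∈ Set.Ioo (-1 : ℝ) 1 := by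
  constructor
  · rintro ⟨a', b', ha, hb, e⟩
    obtain ⟨rfl, rfl⟩ := comb_inj h e
    exact ⟨ha, hb⟩
  · rintro ⟨ha, hb⟩
    exact ⟨a, b, ha, hb, rfl⟩

/-- A parallelogram that is symmetric about the origin is centred there. -/
theorem IsParallelogram.exists_eq_openParallelogram {P : Set Plane} (hP : IsParallelogram P)
    (hsymm : ∀ x ∈ P, -x ∈ P) : ∃ u v, wedge u v ≠ 0 ∧ P = openParallelogram u v := by
  obtain ⟨c, u, v, hli, hPeq⟩ := hP
  have huv : wedge u v ≠ 0 := by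
    intro h0
    rw [LinearIndependent.pair_iff] at hli
    have hcomb : ∀ i, v i • u + (-u i) • v = 0 := by
      intro i
      have h0' : u 0 * v 1 - u 1 * v 0 = 0 := h0
      ext j
      fin_cases i <;> fin_cases j <;> simp <;> linarith
    have hu : ∀ i, u i = 0 := fun i => neg_eq_zero.1 (hli _ _ (hcomb i)).2
    exact one_ne_zero (hli 1 0 (by ext i; simp [hu i])).1
  obtain ⟨α, β, rfl⟩ := exists_comb_of_wedge_ne_zero c huv
  have key : ∀ a ∈ Set.Ioo (-1 : ℝ) 1, ∀ b ∈ Set.Ioo (-1 : ℝ) 1,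
      -2 * α - a ∈ Set.Ioo (-1 : ℝ) 1 ∧ -2 * β - b ∈ Set.Ioo (-1 : ℝ) 1 := by
    intro a ha b hb
    have h1 : α • u + β • v + a • u + b • v ∈ P := by rw [hPeq]; exact ⟨a, b, ha, hb, rfl⟩
    have h2 := hsymm _ h1
    rw [hPeq] at h2
    obtain ⟨a', b', ha', hb', e⟩ := h2
    have := comb_inj huv (a := -2 * α - a) (b := -2 * β - b) (c := a') (d := b') (by
      have e' : a' • u + b' • v = -(α • u + β • v + a • u + b • v) - (α • u + β • v) := by
        rw [e]; module
      rw [e']; module)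
    rw [this.1, this.2]
    exact ⟨ha', hb'⟩
  have hz : (0 : ℝ) ∈ Set.Ioo (-1 : ℝ) 1 := by norm_num
  -- a translate of `(-1, 1)` that is symmetric about `0` is not translated at all
  have shift : ∀ x : ℝ, (∀ a ∈ Set.Ioo (-1 : ℝ) 1, -2 * x - a ∈ Set.Ioo (-1 : ℝ) 1) → x = 0 := by
    intro x hx
    have h0 := hx 0 hz
    rw [Set.mem_Ioo] at h0
    rcases lt_trichotomy x 0 with h | h | h
    · have := (hx (-1 - x) ⟨by linarith, by linarith⟩).2
      linarith
    · exact h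
    · have := (hx (1 - x) ⟨by linarith, by linarith⟩).1
      linarith
  have hα := shift α fun a ha => (key a ha 0 hz).1
  have hβ := shift β fun b hb => (key 0 hz b hb).2
  refine ⟨u, v, huv, ?_⟩
  rw [hPeq, hα, hβ]
  simp [openParallelogram]

theorem volume_openParallelogram (u v : Plane) :
    volume (openParallelogram u v) = ENNReal.ofReal |wedge u v| * 4 := by
  set f : Plane →ₗ[ℝ] Plane := Matrix.toLin' !![u 0, v 0; u 1, v 1]
  have hf : ∀ x : Plane, f x = x 0 • u + x 1 • v := fun x => by
    ext i; fin_cases i <;> simp [f, Matrix.mulVec, dotProduct, Fin.sum_univ_two] <;> ring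
  have himg : openParallelogram u v = f '' (Set.univ.pi fun _ => Set.Ioo (-1 : ℝ) 1) := by
    ext x
    constructor
    · rintro ⟨a, b, ha, hb, rfl⟩
      refine ⟨![a, b], fun i _ => ?_, by rw [hf]; simp⟩
      fin_cases i
      · exact ha
      · exact hb
    · rintro ⟨y, hy, rfl⟩
      exact ⟨y 0, y 1, hy 0 trivial, hy 1 trivial, hf y⟩
  rw [himg, Measure.addHaar_image_linearMap, LinearMap.det_toLin', det_columns, Real.volume_pi_Ioo]
  congr 1
  rw [Fin.prod_univ_two, ← ENNReal.ofReal_mul (by norm_num)]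
  norm_num

/-- A domain that properly contains a parallelogram has a larger critical determinant, by
Minkowski's theorem. -/
theorem criticalDet_lt_of_isParallelogram {K P : Set Plane} (hK : IsSymmConvexDomain K)
    (hP : IsSymmConvexDomain P) (hPp : IsParallelogram P) (hPK : P ⊂ K) :
    criticalDet P < criticalDet K := by
  obtain ⟨u, v, huv, hPeq⟩ := hPp.exists_eq_openParallelogram hP.symm
  have h1 : criticalDet P ≤ |wedge u v| := by
    rw [← covol_latticeMk huv]
    refine criticalDet_le_covol ((isAdmissible_latticeMk hP huv).2 fun a b hab => ?_)
    rw [hP.one_le_gauge_iff, hPeq, mem_openParallelogram_iff huv]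
    rintro ⟨ha, hb⟩
    have ha' : a ∈ Set.Ioo (-1 : ℤ) 1 := ⟨by exact_mod_cast ha.1, by exact_mod_cast ha.2⟩
    have hb' : b ∈ Set.Ioo (-1 : ℤ) 1 := ⟨by exact_mod_cast hb.1, by exact_mod_cast hb.2⟩
    rw [Set.mem_Ioo] at ha' hb'
    omega
  refine h1.trans_lt ?_
  obtain ⟨p, q, hpq⟩ := hK.exists_criticalHexagon
  have h2 := hK.volume_le hpq.pos.ne' (hK.isAdmissible_of_hexagon hpq.1)
  rw [hpq.wedge_eq, abs_of_pos hK.criticalDet_pos] at h2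
  have hopen : IsOpen (K \ closure P) := hK.isOpen.sdiff isClosed_closure
  have hne : (K \ closure P).Nonempty := by
    rw [Set.nonempty_iff_ne_empty, Ne, Set.sdiff_eq_empty]
    intro hsub
    refine hPK.2 ((interior_maximal hsub hK.isOpen).trans ?_)
    rw [hP.convex.interior_closure_eq_interior_of_nonempty_interior
      (by rw [hP.isOpen.interior_eq]; exact hP.nonempty), hP.isOpen.interior_eq]
  have h3 : volume P + volume (K \ closure P) ≤ volume K := by
    rw [← measure_union (Set.disjoint_left.2 fun x hx hx' => hx'.2 (subset_closure hx))
      hopen.measurableSet]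
    exact measure_mono (Set.union_subset hPK.1 Set.sdiff_subset)
  have h4 : volume P < volume P + volume (K \ closure P) :=
    ENNReal.lt_add_right hP.isBounded.measure_lt_top.ne (hopen.measure_pos volume hne).ne'
  have h5 := (h4.trans_le h3).trans_le h2
  rw [hPeq, volume_openParallelogram] at h5
  have h6 := lt_of_mul_lt_mul_right' h5
  exact (ENNReal.ofReal_lt_ofReal_iff hK.criticalDet_pos).1 h6

end Parallelogram

theorem corollary1p5 (K : Set Plane) (hK : IsSymmConvexDomain K) (hKp : ¬ IsParallelogram K) :
    ∃ H : Set Plane, IsIrreducibleDomain H ∧ ¬ IsParallelogram H ∧ H ⊆ K ∧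
      criticalDet H = criticalDet K ∧
      IsEmbeddedCircle (criticalLocus H) ∧
      criticalLocus K ⊆ criticalLocus H ∧ IsClosed (criticalLocus K) := by
  obtain ⟨H, hH, hHK, hdet⟩ := hK.exists_irreducible_subset
  have hHp : ¬ IsParallelogram H := fun hp => by
    refine (criticalDet_lt_of_isParallelogram hK hH.1 hp ⟨hHK, fun h => hKp ?_⟩).ne hdet
    rwa [Set.Subset.antisymm h hHK]
  exact ⟨H, hH, hHp, hHK, hdet, hH.isEmbeddedCircle_criticalLocus hHp,
    fun L hL => ⟨hH.1.isAdmissible_anti hHK hL.1, hL.2.trans hdet.symm⟩,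
    hK.isClosed_criticalLocus⟩
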